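/- Let $P$ be the surface of a regular tetrahedron, a regular octahedron, a cube, or a regular icosahedron in Euclidean $3$-space, equipped with its intrinsic flat metric, which has a cone singularity at each vertex; away from the vertices, $P$ is locally isometric to the Euclidean plane, two faces adjacent along an edge being unfolded into a common plane. A *closed saddle connection* on $P$ is a geodesic segment of positive length on $P$ (that is, a path which is a straight line in the faces and in the unfoldings of adjacent faces across their common edge) which starts and ends at one and the same vertex of $P$ and contains no vertex of $P$ in its interior. Then there are no closed saddle connections on $P$. -/

import Mathlib

namespace Platonic

/-- Euclidean 3-space, in which the solids live. -/
abbrev E3 : Type := EuclideanSpace ℝ (Fin 3)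

/-- The Euclidean plane, in which the flat charts take their values. -/
abbrev E2 : Type := EuclideanSpace ℝ (Fin 2)

/-- A polyhedral surface in space, given by its set of vertices and its set of (closed, convex,
polygonal) faces.  Only the four surfaces defined explicitly below are used. -/
structure PolyhedralSurface where
  vertices : Set E3
  faces : Set (Set E3)

namespace PolyhedralSurface

/-- The underlying point set of the surface: the union of its faces. -/
def carrier (P : PolyhedralSurface) : Set E3 := ⋃₀ P.faces

/-- A flat chart of the surface punctured at its vertices, with domain `U ∩ P.carrier`.  It is an
injective map to the plane which preserves distances within each single face.  Around an interior
point of a face, such a map is a rigid motion of the face into the plane.  Around an interior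
point of an edge it is a rigid motion on each of the two adjacent faces, the two motions agree on
the edge, and by injectivity they put the two faces on opposite sides of it: it unfolds the two
faces into the plane.  (Values of `φ` off `U ∩ P.carrier` are irrelevant.) -/
structure IsFlatChart (P : PolyhedralSurface) (U : Set E3) (φ : E3 → E2) : Prop where
  isOpen : IsOpen U
  not_vertex : ∀ v ∈ P.vertices, v ∉ U
  injOn : Set.InjOn φ (U ∩ P.carrier)
  dist_eq : ∀ F ∈ P.faces, ∀ x ∈ U ∩ F, ∀ y ∈ U ∩ F, dist (φ x) (φ y) = dist x y

/-- Near the time `t`, the path `γ` runs on the surface minus the vertices and is a unit-speed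
straight line when it is read in some flat chart. -/
def IsStraightAt (P : PolyhedralSurface) (γ : ℝ → E3) (t : ℝ) : Prop :=
  ∃ (U : Set E3) (φ : E3 → E2), P.IsFlatChart U φ ∧
    ∃ u : E2, ‖u‖ = 1 ∧ ∃ ε : ℝ, 0 < ε ∧
      ∀ s ∈ Set.Ioo (t - ε) (t + ε), γ s ∈ U ∩ P.carrier ∧ φ (γ s) = φ (γ t) + (s - t) • u

/-- `γ`, restricted to `[0, L]`, is a saddle connection from the vertex `p` to the vertex `q`:
a path on the surface, parametrized by arc length, of positive length `L`, that is a geodesic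
(a straight line in the flat charts) and meets no vertex at interior times. -/
structure IsSaddleConnection (P : PolyhedralSurface) (γ : ℝ → E3) (L : ℝ) (p q : E3) :
    Prop where
  pos : 0 < L
  start_mem : p ∈ P.vertices
  end_mem : q ∈ P.vertices
  continuousOn : ContinuousOn γ (Set.Icc 0 L)
  mem_carrier : ∀ t ∈ Set.Icc 0 L, γ t ∈ P.carrier
  start_eq : γ 0 = p
  end_eq : γ L = q
  not_vertex : ∀ t ∈ Set.Ioo 0 L, γ t ∉ P.vertices
  straight : ∀ t ∈ Set.Ioo 0 L, P.IsStraightAt γ t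

/-- The surface has a closed saddle connection: one that returns to the vertex it started at. -/
def HasClosedSaddleConnection (P : PolyhedralSurface) : Prop :=
  ∃ (γ : ℝ → E3) (L : ℝ) (v : E3), P.IsSaddleConnection γ L v v

/-- The surface with vertex set `V` whose faces are all the equilateral triangles of side `ℓ`
with corners in `V`. -/
def ofTriangles (V : Set E3) (ℓ : ℝ) : PolyhedralSurface where
  vertices := V
  faces := {F | ∃ a ∈ V, ∃ b ∈ V, ∃ c ∈ V,
    dist a b = ℓ ∧ dist b c = ℓ ∧ dist c a = ℓ ∧ F = convexHull ℝ {a, b, c}}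

end PolyhedralSurface

open PolyhedralSurface

/-- The regular tetrahedron inscribed in the cube `[-1, 1]³`; its edges have length `2 √2`. -/
noncomputable def tetrahedron : PolyhedralSurface :=
  ofTriangles {!₂[1, 1, 1], !₂[1, -1, -1], !₂[-1, 1, -1], !₂[-1, -1, 1]} (2 * √2)

/-- The regular octahedron with vertices `± eᵢ`; its edges have length `√2`. -/
noncomputable def octahedron : PolyhedralSurface :=
  ofTriangles {!₂[1, 0, 0], !₂[-1, 0, 0], !₂[0, 1, 0], !₂[0, -1, 0], !₂[0, 0, 1], !₂[0, 0, -1]}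
    (√2)

/-- The regular icosahedron, whose twelve vertices are the cyclic permutations of
`(0, ±1, ±φ)`, with `φ` the golden ratio; its edges have length `2`. -/
noncomputable def icosahedron : PolyhedralSurface :=
  ofTriangles {x | ∃ s t : ℝ, (s = 1 ∨ s = -1) ∧ (t = Real.goldenRatio ∨ t = -Real.goldenRatio) ∧
    (x = !₂[0, s, t] ∨ x = !₂[s, t, 0] ∨ x = !₂[t, 0, s])} 2

/-- The surface of the cube `[-1, 1]³`, with its eight vertices `(±1, ±1, ±1)` and its six square
faces, on each of which one coordinate is `1` or `-1`. -/
def cube : PolyhedralSurface where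
  vertices := {x | ∀ i, x i = 1 ∨ x i = -1}
  faces := {F | ∃ (i : Fin 3) (s : ℝ), (s = 1 ∨ s = -1) ∧
    F = {x | x i = s ∧ ∀ j, |x j| ≤ 1}}

end Platonic

namespace Platonic

open Filter Topology Set PolyhedralSurface

/-! ### The local structure of a surface at a point which is not a vertex -/

/-! The proof develops a geodesic along a lattice tiling and then uses a rotational symmetry of the
solid. Place one face met by a saddle connection `γ` in space so that its corners lie in a group `Λ`
whose nonzero vectors have norm at least the edge length `ℓ`. Unfolding the neighbouring face into
the same plane puts its corners at points `a + b - c` with `a`, `b`, `c` corners of the first face,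
hence again in `Λ`: equilateral triangles and squares both have this property. So `γ` develops into
a segment `z + s • u` whose two ends lie in `Λ`, and twice the developed midpoint lies in `Λ`
(`IsRollable.exists_midpoint`).

A non-vertex point of a face with this property is the midpoint of an edge or, for the cube,
possibly the centre of a face (`MinNorm.exists_half_int`). In each case the rotation `R` of the
solid by a half-turn about the axis through that point preserves the surface and acts on its tangent
directions there by `-1`. Hence `s ↦ R (γ (L - s))` is a geodesic with the same germ as `γ` at `L /
2`; by unique continuation the two coincide, and `R` exchanges the endpoints of `γ`. The axis
contains no vertex, so `R` fixes none, and the endpoints are different.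

Geodesics are handled through hinges: near a non-vertex the surface is two half-planes glued along a
line, a flat chart is affine in the unfolded coordinates (`IsHinge.exists_frame`), and a geodesic is
linear in them (`IsStraightAt.exists_onHinge`). Both the development and the coincidence with the
rotated path are propagated over `(0, L)` by a connectedness argument (`forall_Ioo_of_frequently`).
`IsRollable` collects what this uses; it is verified for the cube in coordinates, and for the three
triangulated solids through `IsDeltahedral`, a condition on inner products of vertices. -/

/-- The point with coordinates `(x, y)` in the unfolding, around `p`, of two half-planes which meet
along the line through `p` in direction `τ` and extend from it in the directions `n₁`, `n₂`. -/
noncomputable def hingePoint (p τ n₁ n₂ : E3) (x y : ℝ) : E3 :=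
  p + x • τ + max y 0 • n₁ + max (-y) 0 • n₂

/-- The half-plane `F` side of a hinge: an orthogonal coordinate system in the plane of `F`. -/
def InHalfPlane (F : Set E3) (p τ n n' : E3) : Prop :=
  ∀ q ∈ F, ∃ x y : ℝ, q = p + x • τ + y • n ∧ (0 ≤ y ∨ n' = -n)

/-- Unfolding `F'` into the plane of `F` puts the corners of `F'` at points of the form
`a + b - c` with `a`, `b`, `c` corners of `F`. -/
def FlipsInto (V F F' : Set E3) (p τ n n' : E3) : Prop :=
  ∀ v ∈ V ∩ F', ∃ a ∈ V ∩ F, ∃ b ∈ V ∩ F, ∃ c ∈ V ∩ F, ∃ x y : ℝ,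
    v = p + x • τ + y • n' ∧ a + b - c = p + x • τ - y • n

/-- The faces at the point `p` are `F₁` and `F₂`, which meet along an edge in direction `τ`, and
extend from it in the directions `n₁` and `n₂`. The case `F₁ = F₂`, `n₂ = -n₁` of an interior point
of a face is included. -/
structure IsHinge (P : PolyhedralSurface) (p : E3) (F₁ F₂ : Set E3) (τ n₁ n₂ : E3) : Prop where
  left_mem : F₁ ∈ P.faces
  right_mem : F₂ ∈ P.faces
  mem_left : p ∈ F₁
  mem_right : p ∈ F₂
  eq_or_eq : ∀ F ∈ P.faces, p ∈ F → F = F₁ ∨ F = F₂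
  tangent_ne : τ ≠ 0
  normal_ne : n₁ ≠ 0
  inner_left : inner ℝ τ n₁ = 0
  inner_right : inner ℝ τ n₂ = 0
  norm_eq : ‖n₁‖ = ‖n₂‖
  ne : n₁ ≠ n₂
  left_subset : InHalfPlane F₁ p τ n₁ n₂
  right_subset : InHalfPlane F₂ p τ n₂ n₁
  near : ∃ ε > (0 : ℝ), ∀ δ : ℝ, 0 < δ → δ < ε →
    p + δ • τ ∈ F₁ ∩ F₂ ∧ p + δ • n₁ ∈ F₁ ∧ p + δ • n₂ ∈ F₂
  flip_left : FlipsInto P.vertices F₁ F₂ p τ n₁ n₂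
  flip_right : FlipsInto P.vertices F₂ F₁ p τ n₂ n₁

namespace IsHinge

variable {P : PolyhedralSurface} {p : E3} {F₁ F₂ : Set E3} {τ n₁ n₂ : E3}

theorem symm (h : IsHinge P p F₁ F₂ τ n₁ n₂) : IsHinge P p F₂ F₁ τ n₂ n₁ where
  left_mem := h.right_mem
  right_mem := h.left_mem
  mem_left := h.mem_right
  mem_right := h.mem_left
  eq_or_eq F hF hp := (h.eq_or_eq F hF hp).symm
  tangent_ne := h.tangent_ne
  normal_ne := norm_ne_zero_iff.1 (h.norm_eq ▸ norm_ne_zero_iff.2 h.normal_ne)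
  inner_left := h.inner_right
  inner_right := h.inner_left
  norm_eq := h.norm_eq.symm
  ne := h.ne.symm
  left_subset := h.right_subset
  right_subset := h.left_subset
  near := by
    obtain ⟨ε, hε, H⟩ := h.near
    exact ⟨ε, hε, fun δ h0 h1 => ⟨(H δ h0 h1).1.symm, (H δ h0 h1).2.2, (H δ h0 h1).2.1⟩⟩
  flip_left := h.flip_right
  flip_right := h.flip_left

/-- Coordinates on a hinge are unique. -/
theorem hingePoint_inj (h : IsHinge P p F₁ F₂ τ n₁ n₂) {x y x' y' : ℝ}
    (e : hingePoint p τ n₁ n₂ x y = hingePoint p τ n₁ n₂ x' y') : x = x' ∧ y = y' := by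
  have hτ : inner ℝ τ τ ≠ (0 : ℝ) := inner_self_ne_zero.2 h.tangent_ne
  have hn : ‖n₁‖ ≠ 0 := norm_ne_zero_iff.2 h.normal_ne
  have e1 := congrArg (fun q => inner ℝ τ (q - p)) e
  have hx : x = x' := by
    simp only [hingePoint, inner_sub_right, inner_add_right, inner_smul_right, h.inner_left,
      h.inner_right] at e1
    have : (x - x') * inner ℝ τ τ = 0 := by linarith
    rcases mul_eq_zero.1 this with h0 | h0
    · linarith
    · exact absurd h0 hτ
  refine ⟨hx, ?_⟩
  subst hx
  have e2 : (max y 0 - max y' 0) • n₁ = (max (-y') 0 - max (-y) 0) • n₂ := by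
    have e' := e
    simp only [hingePoint] at e'
    have e3 : max y 0 • n₁ + max (-y) 0 • n₂ = max y' 0 • n₁ + max (-y') 0 • n₂ := by
      have := congrArg (fun q => q - (p + x • τ)) e'
      simpa [add_assoc] using this
    rw [sub_smul, sub_smul, sub_eq_sub_iff_add_eq_add, e3]
    abel
  -- The normals have equal length, so `|s| = |t|`; the case `s = t ≠ 0` would force `n₁ = n₂`.
  have key : ∀ s t : ℝ, s • n₁ = t • n₂ → s = -t ∨ s = 0 := by
    intro s t hst
    have e4 := congrArg norm hst
    rw [norm_smul, norm_smul, ← h.norm_eq] at e4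
    have e5 := mul_right_cancel₀ hn e4
    rcases abs_eq_abs.1 (show |s| = |t| from e5) with h1 | h1
    · right
      subst h1
      by_contra h0
      exact h.ne (smul_right_injective _ h0 hst)
    · exact Or.inl h1
  rcases le_total 0 y with hy | hy <;> rcases le_total 0 y' with hy' | hy'
  all_goals
    have a1 := key _ _ e2
    have a2 : max y 0 - max y' 0 = 0 → max (-y') 0 - max (-y) 0 = 0 := by
      intro h0
      rw [h0, zero_smul] at e2
      rcases smul_eq_zero.1 e2.symm with h1 | h1
      · exact h1
      · exact absurd h1 h.symm.normal_ne
    simp only [hy, hy', max_eq_left, max_eq_right, neg_nonneg, neg_nonpos] at a1 a2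
  · rcases a1 with a1 | a1 <;> linarith
  · rcases a1 with a1 | a1
    · linarith
    · have := a2 a1
      linarith
  · rcases a1 with a1 | a1
    · linarith
    · have := a2 a1
      linarith
  · have := a2 (by ring)
    linarith

/-- A negative `y` is allowed only when `n₂ = -n₁`, and then the two half-planes form one plane,
where `hingePoint` is the usual affine formula. -/
theorem exists_left_eq_hingePoint (h : IsHinge P p F₁ F₂ τ n₁ n₂) {q : E3} (hq : q ∈ F₁) :
    ∃ x y : ℝ, q = p + x • τ + y • n₁ ∧ q = hingePoint p τ n₁ n₂ x y := by
  obtain ⟨x, y, e, h0⟩ := h.left_subset q hq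
  refine ⟨x, y, e, ?_⟩
  rw [e, hingePoint]
  rcases le_total 0 y with hy | hy
  · simp [hy]
  · rcases h0 with h0 | h0
    · have : y = 0 := le_antisymm hy h0
      simp [this]
    · simp [hy, h0]

theorem hingePoint_swap (x y : ℝ) :
    hingePoint p τ n₂ n₁ x y = hingePoint p τ n₁ n₂ x (-y) := by
  simp only [hingePoint, neg_neg]
  abel

theorem exists_right_eq_hingePoint (h : IsHinge P p F₁ F₂ τ n₁ n₂) {q : E3} (hq : q ∈ F₂) :
    ∃ x y : ℝ, q = p + x • τ - y • n₂ ∧ q = hingePoint p τ n₁ n₂ x y := by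
  obtain ⟨x, y, e, e'⟩ := h.symm.exists_left_eq_hingePoint hq
  refine ⟨x, -y, by rw [e]; simp, by rw [e', hingePoint_swap]⟩

end IsHinge

/-! ### Flat charts near a hinge -/

theorem E2.inner_eq (v w : E2) : inner ℝ v w = v 0 * w 0 + v 1 * w 1 := by
  simp [PiLp.inner_apply, Fin.sum_univ_two, mul_comm]

theorem E2.eq_zero_of_inner_eq_zero {T M w : E2} (hT : T ≠ 0) (hM : M ≠ 0)
    (hTM : inner ℝ T M = 0) (h1 : inner ℝ T w = 0) (h2 : inner ℝ M w = 0) : w = 0 := by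
  have aT : inner ℝ T T ≠ (0 : ℝ) := inner_self_ne_zero.2 hT
  have aM : inner ℝ M M ≠ (0 : ℝ) := inner_self_ne_zero.2 hM
  rw [E2.inner_eq] at *
  -- By Lagrange's identity the squared determinant is the Gram determinant, here `‖T‖² ‖M‖²`;
  -- Cramer's rule then gives `w = 0`.
  have hdet : (T 0 * M 1 - T 1 * M 0) ^ 2 ≠ 0 := by
    have e : (T 0 * M 1 - T 1 * M 0) ^ 2 =
        (T 0 * T 0 + T 1 * T 1) * (M 0 * M 0 + M 1 * M 1) - (T 0 * M 0 + T 1 * M 1) ^ 2 := by ring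
    rw [e, hTM]
    simpa using ⟨aT, aM⟩
  have hdet' : T 0 * M 1 - T 1 * M 0 ≠ 0 := fun h0 => hdet (by rw [h0]; ring)
  ext i
  fin_cases i
  · refine (mul_eq_zero.1 (?_ : (T 0 * M 1 - T 1 * M 0) * w 0 = 0)).resolve_left hdet'
    linear_combination M 1 * h1 - T 1 * h2
  · refine (mul_eq_zero.1 (?_ : (T 0 * M 1 - T 1 * M 0) * w 1 = 0)).resolve_left hdet'
    linear_combination T 0 * h2 - M 0 * h1

/-- Polarization: the three distances among `p`, `x`, `y`, all within one face, determine the inner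
product. -/
theorem PolyhedralSurface.IsFlatChart.inner_eq {P : PolyhedralSurface} {U : Set E3} {φ : E3 → E2}
    (h : P.IsFlatChart U φ) {F : Set E3} (hF : F ∈ P.faces) {p x y : E3} (hp : p ∈ U ∩ F)
    (hx : x ∈ U ∩ F) (hy : y ∈ U ∩ F) :
    inner ℝ (φ x - φ p) (φ y - φ p) = inner ℝ (x - p) (y - p) := by
  rw [real_inner_eq_norm_mul_self_add_norm_mul_self_sub_norm_sub_mul_self_div_two,
    real_inner_eq_norm_mul_self_add_norm_mul_self_sub_norm_sub_mul_self_div_two,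
    sub_sub_sub_cancel_right, sub_sub_sub_cancel_right]
  simp only [← dist_eq_norm]
  rw [h.dist_eq F hF x hx p hp, h.dist_eq F hF y hy p hp, h.dist_eq F hF x hx y hy]

/-- On a hinge, a flat chart is affine in the coordinates of the hinge. -/
theorem IsHinge.exists_frame {P : PolyhedralSurface} {p : E3} {F₁ F₂ : Set E3} {τ n₁ n₂ : E3}
    (h : IsHinge P p F₁ F₂ τ n₁ n₂) {U : Set E3} {φ : E3 → E2} (hφ : P.IsFlatChart U φ)
    (hp : p ∈ U) :
    ∃ T M : E2, (∀ x y : ℝ, x • T + y • M = 0 → x = 0 ∧ y = 0) ∧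
      (∀ u, ∃ x y : ℝ, u = x • T + y • M) ∧
      (∀ x y : ℝ, p + x • τ + y • n₁ ∈ U ∩ F₁ →
        φ (p + x • τ + y • n₁) = φ p + (x • T + y • M)) ∧
      (∀ x y : ℝ, p + x • τ - y • n₂ ∈ U ∩ F₂ →
        φ (p + x • τ - y • n₂) = φ p + (x • T + y • M)) := by
  obtain ⟨ε, hε, near⟩ := h.near
  have tend : ∀ v : E3, ∀ᶠ δ in 𝓝[>] (0 : ℝ), p + δ • v ∈ U := by
    intro v
    have : Tendsto (fun δ : ℝ => p + δ • v) (𝓝 0) (𝓝 (p + (0 : ℝ) • v)) :=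
      Continuous.tendsto (by fun_prop) 0
    rw [zero_smul, add_zero] at this
    exact (this.eventually (hφ.isOpen.mem_nhds hp)).filter_mono nhdsWithin_le_nhds
  obtain ⟨δ, ⟨⟨⟨uτ, u1⟩, u2⟩, hδ'⟩, hδ⟩ := ((((tend τ).and (tend n₁)).and (tend n₂)).and
    ((eventually_lt_nhds hε).filter_mono nhdsWithin_le_nhds) |>.and self_mem_nhdsWithin).exists
  replace hδ : 0 < δ := hδ
  obtain ⟨⟨fτ1, fτ2⟩, f1, f2⟩ := near δ hδ hδ'
  have hp1 : p ∈ U ∩ F₁ := ⟨hp, h.mem_left⟩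
  have hp2 : p ∈ U ∩ F₂ := ⟨hp, h.mem_right⟩
  have hδ0 : δ ≠ 0 := hδ.ne'
  have i1 := fun x y (hx : x ∈ U ∩ F₁) (hy : y ∈ U ∩ F₁) => hφ.inner_eq h.left_mem hp1 hx hy
  have i2 := fun x y (hx : x ∈ U ∩ F₂) (hy : y ∈ U ∩ F₂) => hφ.inner_eq h.right_mem hp2 hx hy
  -- `T`, `M`, `N` are the images under the chart of `τ`, `n₁`, `n₂`, rescaled from a step `δ` short
  -- enough to stay in `U` and in the faces.
  set T : E2 := δ⁻¹ • (φ (p + δ • τ) - φ p) with hT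
  set M : E2 := δ⁻¹ • (φ (p + δ • n₁) - φ p) with hM
  set N : E2 := δ⁻¹ • (φ (p + δ • n₂) - φ p) with hN
  have T1 : ∀ q ∈ U ∩ F₁, inner ℝ T (φ q - φ p) = inner ℝ τ (q - p) := by
    intro q hq
    rw [hT, inner_smul_left, i1 _ _ ⟨uτ, fτ1⟩ hq, add_sub_cancel_left, inner_smul_left]
    simp [hδ0]
  have T2 : ∀ q ∈ U ∩ F₂, inner ℝ T (φ q - φ p) = inner ℝ τ (q - p) := by
    intro q hq
    rw [hT, inner_smul_left, i2 _ _ ⟨uτ, fτ2⟩ hq, add_sub_cancel_left, inner_smul_left]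
    simp [hδ0]
  have M1 : ∀ q ∈ U ∩ F₁, inner ℝ M (φ q - φ p) = inner ℝ n₁ (q - p) := by
    intro q hq
    rw [hM, inner_smul_left, i1 _ _ ⟨u1, f1⟩ hq, add_sub_cancel_left, inner_smul_left]
    simp [hδ0]
  have N2 : ∀ q ∈ U ∩ F₂, inner ℝ N (φ q - φ p) = inner ℝ n₂ (q - p) := by
    intro q hq
    rw [hN, inner_smul_left, i2 _ _ ⟨u2, f2⟩ hq, add_sub_cancel_left, inner_smul_left]
    simp [hδ0]
  have TT : inner ℝ T T = inner ℝ τ τ := by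
    conv_lhs => rw [hT, inner_smul_right, ← hT, T1 _ ⟨uτ, fτ1⟩, add_sub_cancel_left,
      inner_smul_right]
    simp [hδ0]
  have TM : inner ℝ T M = 0 := by
    rw [hM, inner_smul_right, T1 _ ⟨u1, f1⟩, add_sub_cancel_left, inner_smul_right, h.inner_left]
    simp
  have TN : inner ℝ T N = 0 := by
    rw [hN, inner_smul_right, T2 _ ⟨u2, f2⟩, add_sub_cancel_left, inner_smul_right, h.inner_right]
    simp
  have MM : inner ℝ M M = inner ℝ n₁ n₁ := by
    conv_lhs => rw [hM, inner_smul_right, ← hM, M1 _ ⟨u1, f1⟩, add_sub_cancel_left,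
      inner_smul_right]
    simp [hδ0]
  have NN : inner ℝ N N = inner ℝ n₁ n₁ := by
    conv_lhs => rw [hN, inner_smul_right, ← hN, N2 _ ⟨u2, f2⟩, add_sub_cancel_left,
      inner_smul_right]
    rw [real_inner_self_eq_norm_sq n₁, h.norm_eq, real_inner_self_eq_norm_sq]
    simp [hδ0]
  clear_value T M N
  have T0 : T ≠ 0 := inner_self_ne_zero.1 (TT ▸ inner_self_ne_zero.2 h.tangent_ne)
  have M0 : M ≠ 0 := inner_self_ne_zero.1 (MM ▸ inner_self_ne_zero.2 h.normal_ne)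
  have aT : inner ℝ T T ≠ (0 : ℝ) := inner_self_ne_zero.2 T0
  have aM : inner ℝ M M ≠ (0 : ℝ) := inner_self_ne_zero.2 M0
  have MT : inner ℝ M T = 0 := by rw [real_inner_comm, TM]
  have span : ∀ u, u = (inner ℝ T u / inner ℝ T T) • T + (inner ℝ M u / inner ℝ M M) • M := by
    intro u
    rw [← sub_eq_zero]
    refine E2.eq_zero_of_inner_eq_zero T0 M0 TM ?_ ?_
    · rw [inner_sub_right, inner_add_right, inner_smul_right, inner_smul_right, TM]
      field_simp
      ring
    · rw [inner_sub_right, inner_add_right, inner_smul_right, inner_smul_right, MT]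
      field_simp
      ring
  -- `N` is orthogonal to `T` and as long as `M`, so `N = ± M`. The sign `+` would fold the two
  -- faces onto each other, against the injectivity of the chart.
  have NM : N = -M := by
    have e := span N
    rw [TN, zero_div, zero_smul, zero_add] at e
    set k := inner ℝ M N / inner ℝ M M
    have e2 : k * k = 1 := by
      have := NN
      rw [e, inner_smul_left, inner_smul_right, ← MM, ← mul_assoc] at this
      exact mul_right_cancel₀ aM (by simpa using this)
    rcases mul_self_eq_one_iff.1 e2 with hk | hk
    · exfalso
      rw [hk, one_smul, hN, hM] at e
      have e3 := smul_right_injective _ (inv_ne_zero hδ0) e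
      have e4 := hφ.injOn ⟨u2, F₂, h.right_mem, f2⟩ ⟨u1, F₁, h.left_mem, f1⟩
        (sub_left_injective e3)
      exact h.ne (smul_right_injective _ hδ0 (add_right_injective _ e4)).symm
    · rw [e, hk, neg_one_smul]
  refine ⟨T, M, ?_, fun u => ⟨_, _, span u⟩, ?_, ?_⟩
  · intro x y e
    have e1 := congrArg (inner ℝ T) e
    have e2 := congrArg (inner ℝ M) e
    rw [inner_add_right, inner_smul_right, inner_smul_right, TM, inner_zero_right] at e1
    rw [inner_add_right, inner_smul_right, inner_smul_right, MT, inner_zero_right] at e2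
    constructor
    · simpa [T0] using e1
    · simpa [M0] using e2
  · intro x y hq
    rw [← sub_eq_iff_eq_add', ← sub_eq_zero]
    refine E2.eq_zero_of_inner_eq_zero T0 M0 TM ?_ ?_
    · rw [inner_sub_right, T1 _ hq, inner_add_right, inner_smul_right, inner_smul_right, TM, TT,
        add_assoc, add_sub_cancel_left, inner_add_right, inner_smul_right, inner_smul_right,
        h.inner_left]
      ring
    · rw [inner_sub_right, M1 _ hq, inner_add_right, inner_smul_right, inner_smul_right, MT, MM,
        add_assoc, add_sub_cancel_left, inner_add_right, inner_smul_right, inner_smul_right,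
        real_inner_comm, h.inner_left]
      ring
  · intro x y hq
    rw [← sub_eq_iff_eq_add', ← sub_eq_zero]
    have hN2 := N2 _ hq
    rw [NM, inner_neg_left] at hN2
    refine E2.eq_zero_of_inner_eq_zero T0 M0 TM ?_ ?_
    · rw [inner_sub_right, T2 _ hq, inner_add_right, inner_smul_right, inner_smul_right, TM, TT,
        add_sub_assoc, add_sub_cancel_left, inner_sub_right, inner_smul_right, inner_smul_right,
        h.inner_right]
      ring
    · rw [inner_sub_right, neg_eq_iff_eq_neg.1 hN2, inner_add_right, inner_smul_right,
        inner_smul_right, MT, MM, add_sub_assoc, add_sub_cancel_left, inner_sub_right,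
        inner_smul_right, inner_smul_right, real_inner_comm, h.inner_right,
        real_inner_self_eq_norm_sq, real_inner_self_eq_norm_sq, h.norm_eq]
      ring

/-! ### Geodesics in hinge coordinates and continuation along an interval -/

/-- The point `q` of the surface has coordinates `(x, y)` on the hinge. -/
structure OnHinge (P : PolyhedralSurface) (p : E3) (F₁ F₂ : Set E3) (τ n₁ n₂ : E3) (x y : ℝ)
    (q : E3) : Prop where
  mem_or_mem : q ∈ F₁ ∨ q ∈ F₂
  eq_or_eq : ∀ F ∈ P.faces, q ∈ F → F = F₁ ∨ F = F₂
  left : q ∈ F₁ → q = p + x • τ + y • n₁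
  right : q ∈ F₂ → q = p + x • τ - y • n₂
  eq_hingePoint : q = hingePoint p τ n₁ n₂ x y

theorem OnHinge.symm {P : PolyhedralSurface} {p : E3} {F₁ F₂ : Set E3} {τ n₁ n₂ : E3} {x y : ℝ}
    {q : E3} (h : OnHinge P p F₁ F₂ τ n₁ n₂ x y q) : OnHinge P p F₂ F₁ τ n₂ n₁ x (-y) q where
  mem_or_mem := h.mem_or_mem.symm
  eq_or_eq F hF hq := (h.eq_or_eq F hF hq).symm
  left hq := by rw [neg_smul, ← sub_eq_add_neg]; exact h.right hq
  right hq := by rw [neg_smul, sub_neg_eq_add]; exact h.left hq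
  eq_hingePoint := by rw [IsHinge.hingePoint_swap, neg_neg]; exact h.eq_hingePoint

/-- Finitely many closed faces miss `p`, so a neighbourhood of `p` avoids them all. This makes the
faces at `p` the only ones to consider nearby. -/
theorem eventually_mem_face {S : Set (Set E3)} (hfin : S.Finite) (hcl : ∀ F ∈ S, IsClosed F)
    (p : E3) : ∀ᶠ q in 𝓝 p, ∀ F ∈ S, q ∈ F → p ∈ F := by
  rw [Filter.eventually_all_finite hfin]
  intro F hF
  by_cases hp : p ∈ F
  · exact Eventually.of_forall fun _ _ => hp
  · filter_upwards [(hcl F hF).isOpen_compl.mem_nhds hp] with q hq hq'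
    exact absurd hq' hq

/-- A geodesic has constant velocity in the coordinates of a hinge. -/
theorem PolyhedralSurface.IsStraightAt.exists_onHinge {P : PolyhedralSurface}
    (hfin : P.faces.Finite) (hcl : ∀ F ∈ P.faces, IsClosed F) {γ : ℝ → E3} {t : ℝ}
    {F₁ F₂ : Set E3} {τ n₁ n₂ : E3}
    (h : IsHinge P (γ t) F₁ F₂ τ n₁ n₂) (hγ : ContinuousAt γ t) (hs : P.IsStraightAt γ t) :
    ∃ α β : ℝ, ∀ᶠ s in 𝓝 t,
      OnHinge P (γ t) F₁ F₂ τ n₁ n₂ ((s - t) * α) ((s - t) * β) (γ s) := by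
  obtain ⟨U, φ, hφ, u, -, ε, hε, H⟩ := hs
  have hU : γ t ∈ U := (H t ⟨by linarith, by linarith⟩).1.1
  obtain ⟨T, M, indep, span, c1, c2⟩ := h.exists_frame hφ hU
  obtain ⟨α, β, rfl⟩ := span u
  refine ⟨α, β, ?_⟩
  have e0 := hγ.eventually (eventually_mem_face hfin hcl (γ t))
  filter_upwards [e0, Ioo_mem_nhds (show t - ε < t by linarith) (show t < t + ε by linarith)]
    with s hs1 hs2
  obtain ⟨⟨hsU, F, hF, hsF⟩, hline⟩ := H s hs2
  have heq : ∀ F ∈ P.faces, γ s ∈ F → F = F₁ ∨ F = F₂ := fun F hF hs =>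
    h.eq_or_eq F hF (hs1 F hF hs)
  have solve : ∀ x y : ℝ, φ (γ s) = φ (γ t) + (x • T + y • M) →
      x = (s - t) * α ∧ y = (s - t) * β := by
    intro x y e
    rw [hline] at e
    have e1 := add_left_cancel e
    have := indep (x - (s - t) * α) (y - (s - t) * β) (by
      rw [smul_add, smul_smul, smul_smul] at e1
      rw [sub_smul, sub_smul, sub_add_sub_comm, ← e1, sub_self])
    exact ⟨sub_eq_zero.1 this.1, sub_eq_zero.1 this.2⟩
  have left : γ s ∈ F₁ → γ s = γ t + ((s - t) * α) • τ + ((s - t) * β) • n₁ ∧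
      γ s = hingePoint (γ t) τ n₁ n₂ ((s - t) * α) ((s - t) * β) := by
    intro hq
    obtain ⟨x, y, e1, e2⟩ := h.exists_left_eq_hingePoint hq
    have e3 := c1 x y (e1 ▸ ⟨hsU, hq⟩)
    rw [← e1] at e3
    obtain ⟨rfl, rfl⟩ := solve x y e3
    exact ⟨e1, e2⟩
  have right : γ s ∈ F₂ → γ s = γ t + ((s - t) * α) • τ - ((s - t) * β) • n₂ ∧
      γ s = hingePoint (γ t) τ n₁ n₂ ((s - t) * α) ((s - t) * β) := by
    intro hq
    obtain ⟨x, y, e1, e2⟩ := h.exists_right_eq_hingePoint hq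
    have e3 := c2 x y (e1 ▸ ⟨hsU, hq⟩)
    rw [← e1] at e3
    obtain ⟨rfl, rfl⟩ := solve x y e3
    exact ⟨e1, e2⟩
  have hmem : γ s ∈ F₁ ∨ γ s ∈ F₂ := by
    rcases heq F hF hsF with rfl | rfl
    · exact Or.inl hsF
    · exact Or.inr hsF
  exact ⟨hmem, heq, fun hq => (left hq).1, fun hq => (right hq).1,
    hmem.elim (fun hq => (left hq).2) fun hq => (right hq).2⟩

/-- A property which, wherever it holds at points arbitrarily close to a point of an interval,
holds around that point, holds on the interval as soon as it holds once. -/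
theorem forall_Ioo_of_frequently {a b : ℝ} {Q : ℝ → Prop}
    (H : ∀ t ∈ Ioo a b, (∃ᶠ s in 𝓝 t, Q s) → ∀ᶠ s in 𝓝 t, Q s) {t₀ : ℝ} (ht₀ : t₀ ∈ Ioo a b)
    (h0 : Q t₀) : ∀ t ∈ Ioo a b, Q t := by
  -- The set where `Q` holds locally is open, and `H` makes it relatively closed in the connected
  -- interval.
  have sub : Ioo a b ⊆ {t | ∀ᶠ s in 𝓝 t, Q s} := by
    refine isPreconnected_Ioo.subset_of_closure_inter_subset isOpen_setOfPred_eventually_nhds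
      ⟨t₀, ht₀, H t₀ ht₀ ?_⟩ ?_
    · rw [frequently_iff]
      exact fun hU => ⟨t₀, mem_of_mem_nhds hU, h0⟩
    · rintro t ⟨ht, ht'⟩
      refine H t ht' ((mem_closure_iff_frequently.1 ht).mono fun s hs => ?_)
      exact Eventually.self_of_nhds hs
  exact fun t ht => (sub ht).self_of_nhds

/-! ### Unfolding across an edge and development into a lattice -/

/-- The reflection in the plane through `p` which is orthogonal to `n`. -/
noncomputable def mirror (p n : E3) : E3 →ᵃⁱ[ℝ] E3 :=
  ((AffineIsometryEquiv.vaddConst ℝ p).symm.trans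
    ((ℝ ∙ n)ᗮ.reflection.toAffineIsometryEquiv.trans
      (AffineIsometryEquiv.vaddConst ℝ p))).toAffineIsometry

theorem mirror_apply (p n q : E3) : mirror p n q = (ℝ ∙ n)ᗮ.reflection (q - p) + p := rfl

/-- The mirror of a hinge unfolds one of its half-planes into the plane of the other. -/
theorem IsHinge.mirror_eq {P : PolyhedralSurface} {p : E3} {F₁ F₂ : Set E3} {τ n₁ n₂ : E3}
    (h : IsHinge P p F₁ F₂ τ n₁ n₂) (x y : ℝ) :
    mirror p (n₁ + n₂) (p + x • τ + y • n₂) = p + x • τ - y • n₁ := by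
  -- The mirror fixes `τ` and `n₁ - n₂`, the latter because the normals have equal length, and
  -- negates `n₁ + n₂`; so it sends `n₂` to `-n₁`. At an interior point of a face `n₁ + n₂ = 0` and
  -- the mirror is the identity.
  have e1 : (ℝ ∙ (n₁ + n₂))ᗮ.reflection τ = τ := by
    rw [Submodule.reflection_eq_self_iff, Submodule.mem_orthogonal_singleton_iff_inner_left,
      inner_add_right, h.inner_left, h.inner_right, add_zero]
  have e2 : (ℝ ∙ (n₁ + n₂))ᗮ.reflection (n₁ - n₂) = n₁ - n₂ := by
    rw [Submodule.reflection_eq_self_iff, Submodule.mem_orthogonal_singleton_iff_inner_left,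
      real_inner_comm, inner_add_left, inner_sub_right, inner_sub_right, real_inner_comm n₁ n₂,
      real_inner_self_eq_norm_sq, real_inner_self_eq_norm_sq, h.norm_eq]
    ring
  have e3 := Submodule.reflection_orthogonalComplement_singleton_eq_neg (𝕜 := ℝ) (n₁ + n₂)
  have e4 : (ℝ ∙ (n₁ + n₂))ᗮ.reflection n₂ = -n₁ := by
    have : n₂ = (1 / 2 : ℝ) • ((n₁ + n₂) - (n₁ - n₂)) := by module
    have e5 := congrArg ((ℝ ∙ (n₁ + n₂))ᗮ.reflection) this
    rw [map_smul, map_sub, e2, e3] at e5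
    rw [e5]
    module
  rw [mirror_apply, add_assoc, add_sub_cancel_left, map_add, map_smul, map_smul, e1, e4]
  module

/-- All nonzero elements of `Λ` have norm at least `ℓ`. -/
def MinNorm (Λ : AddSubgroup E3) (ℓ : ℝ) : Prop := ∀ w ∈ Λ, w ≠ 0 → ℓ ≤ ‖w‖

/-- `Λ` is uniformly discrete, hence closed: two of its points within `ℓ / 2` of `z` coincide, so
approximations of `z` are eventually constant. -/
theorem MinNorm.mem_of_forall_exists {Λ : AddSubgroup E3} {ℓ : ℝ} (hℓ : 0 < ℓ) (h : MinNorm Λ ℓ)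
    {z : E3} (hz : ∀ ε > 0, ∃ w ∈ Λ, dist w z < ε) : z ∈ Λ := by
  obtain ⟨w, hw, hwz⟩ := hz (ℓ / 2) (by linarith)
  have : w = z := by
    by_contra hne
    obtain ⟨w', hw', hwz'⟩ := hz (min (ℓ / 2) (dist w z))
      (lt_min (by linarith) (dist_pos.2 hne))
    have h1 := hwz'.trans_le (min_le_left _ _)
    have h2 := hwz'.trans_le (min_le_right _ _)
    have : w = w' := by
      by_contra hne'
      have h3 := h (w - w') (Λ.sub_mem hw hw') (sub_ne_zero.2 hne')
      rw [← dist_eq_norm] at h3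
      have := dist_triangle_right w w' z
      linarith
    exact absurd h2 (this ▸ lt_irrefl _)
  exact this ▸ hw

/-- Near the time `t`, the placement `g` in space of some face along `γ` has its corners in `Λ`
and develops `γ` into the line `z + s • u`. -/
def IsDeveloped (P : PolyhedralSurface) (Λ : AddSubgroup E3) (γ : ℝ → E3) (z u : E3) (t : ℝ) :
    Prop :=
  ∃ F ∈ P.faces, ∃ g : E3 →ᵃⁱ[ℝ] E3, (∀ v ∈ P.vertices ∩ F, g v ∈ Λ) ∧
    ∃ᶠ s in 𝓝[≠] t, γ s ∈ F ∧ g (γ s) = z + s • u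

/-- The mirrored corner is `a + b - c`, and an affine map sends it to `g a + g b - g c`. This is how
lattice placements pass from a face to its neighbour. -/
theorem IsHinge.mirror_mem {P : PolyhedralSurface} {p : E3} {F₁ F₂ : Set E3} {τ n₁ n₂ : E3}
    (h : IsHinge P p F₁ F₂ τ n₁ n₂) {Λ : AddSubgroup E3} {g : E3 →ᵃⁱ[ℝ] E3}
    (hg : ∀ v ∈ P.vertices ∩ F₁, g v ∈ Λ) {v : E3} (hv : v ∈ P.vertices ∩ F₂) :
    g (mirror p (n₁ + n₂) v) ∈ Λ := by
  obtain ⟨a, ha, b, hb, c, hc, x, y, rfl, e⟩ := h.flip_left v hv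
  rw [h.mirror_eq, ← e]
  have : g (a + b - c) = g a + g b - g c := by
    have h1 := g.map_vadd a (b - c)
    have h2 := g.map_vsub b c
    simp only [vadd_eq_add, vsub_eq_sub] at h1 h2
    rw [show a + b - c = b - c + a by abel, h1, h2]
    abel
  rw [this]
  exact Λ.sub_mem (Λ.add_mem (hg a ha) (hg b hb)) (hg c hc)

/-- Two distinct parameters determine an affine line with its parametrization. -/
theorem affineIsometry_line_eq {g : E3 →ᵃⁱ[ℝ] E3} {p W z u : E3} {t s₁ s₂ : ℝ}
    (hne : s₁ ≠ s₂) (h1 : g (p + (s₁ - t) • W) = z + s₁ • u)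
    (h2 : g (p + (s₂ - t) • W) = z + s₂ • u) (s : ℝ) : g (p + (s - t) • W) = z + s • u := by
  have key : ∀ r : ℝ, g (p + r • W) = g p + r • g.linearIsometry W := by
    intro r
    have := g.map_vadd p (r • W)
    simp only [vadd_eq_add, map_smul] at this
    rw [add_comm, this, add_comm]
  rw [key] at *
  have h3 : (s₁ - s₂) • g.linearIsometry W = (s₁ - s₂) • u := by
    have := congrArg₂ (· - ·) h1 h2
    calc _ = g p + (s₁ - t) • g.linearIsometry W - (g p + (s₂ - t) • g.linearIsometry W) := by
          module
      _ = _ := this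
      _ = _ := by module
  have h4 : g.linearIsometry W = u := smul_right_injective _ (sub_ne_zero.2 hne) h3
  rw [h4] at h1 ⊢
  calc _ = (g p + (s₁ - t) • u) + (s - s₁) • u := by module
    _ = (z + s₁ • u) + (s - s₁) • u := by rw [h1]
    _ = _ := by module

/-- On a hinge, the development of a geodesic continues. -/
theorem IsDeveloped.eventually_of_onHinge {P : PolyhedralSurface} {Λ : AddSubgroup E3}
    {γ : ℝ → E3} {z u p : E3} {F₁ F₂ : Set E3} {τ n₁ n₂ : E3} {t α β : ℝ}
    (h : IsHinge P p F₁ F₂ τ n₁ n₂)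
    (hγ : ∀ᶠ s in 𝓝 t, OnHinge P p F₁ F₂ τ n₁ n₂ ((s - t) * α) ((s - t) * β) (γ s))
    {F : Set E3} (hF : F = F₁) {g : E3 →ᵃⁱ[ℝ] E3} (hg : ∀ v ∈ P.vertices ∩ F, g v ∈ Λ)
    {s₁ s₂ : ℝ} (hne : s₁ ≠ s₂)
    (h1 : OnHinge P p F₁ F₂ τ n₁ n₂ ((s₁ - t) * α) ((s₁ - t) * β) (γ s₁))
    (h2 : OnHinge P p F₁ F₂ τ n₁ n₂ ((s₂ - t) * α) ((s₂ - t) * β) (γ s₂))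
    (g1 : γ s₁ ∈ F ∧ g (γ s₁) = z + s₁ • u) (g2 : γ s₂ ∈ F ∧ g (γ s₂) = z + s₂ • u) :
    ∀ᶠ s in 𝓝 t, IsDeveloped P Λ γ z u s := by
  subst hF
  have lin : ∀ s : ℝ, p + ((s - t) * α) • τ + ((s - t) * β) • n₁ =
      p + (s - t) • (α • τ + β • n₁) := by
    intro s
    module
  have hline : ∀ s : ℝ, g (p + ((s - t) * α) • τ + ((s - t) * β) • n₁) = z + s • u := by
    intro s
    rw [lin]
    refine affineIsometry_line_eq hne ?_ ?_ s
    · rw [← lin, ← h1.left g1.1, g1.2]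
    · rw [← lin, ← h2.left g2.1, g2.2]
  filter_upwards [eventually_eventually_nhds.2 hγ] with s hs
  have hs' := (hs.filter_mono (nhdsWithin_le_nhds (s := {s}ᶜ))).frequently
  -- Where `γ` runs in the second face, the placement is `g` after the mirror, which carries the
  -- same line on. One of the two faces must recur near `s`, and that one serves as the face at `s`.
  have : ∃ᶠ s' in 𝓝[≠] s, (γ s' ∈ F ∧ g (γ s') = z + s' • u) ∨
      (γ s' ∈ F₂ ∧ (g.comp (mirror p (n₁ + n₂))) (γ s') = z + s' • u) := by
    refine hs'.mono fun s' h' => ?_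
    rcases h'.mem_or_mem with hm | hm
    · left
      refine ⟨hm, ?_⟩
      rw [h'.left hm]
      exact hline s'
    · right
      refine ⟨hm, ?_⟩
      change g (mirror p (n₁ + n₂) (γ s')) = _
      rw [h'.right hm, sub_eq_add_neg, ← neg_smul, h.mirror_eq, neg_smul, sub_neg_eq_add]
      exact hline s'
  rcases frequently_or_distrib.1 this with h' | h'
  · exact ⟨F, h.left_mem, g, hg, h'⟩
  · exact ⟨F₂, h.right_mem, _, fun v hv => h.mirror_mem hg hv, h'⟩

/-- A developed time close to `t` supplies two distinct times at which one placement follows the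
line, enough to determine it on the whole hinge. This is the hypothesis of
`forall_Ioo_of_frequently`. -/
theorem IsDeveloped.eventually_of_frequently {P : PolyhedralSurface} {Λ : AddSubgroup E3}
    {γ : ℝ → E3} {z u p : E3} {F₁ F₂ : Set E3} {τ n₁ n₂ : E3} {t α β : ℝ}
    (h : IsHinge P p F₁ F₂ τ n₁ n₂)
    (hγ : ∀ᶠ s in 𝓝 t, OnHinge P p F₁ F₂ τ n₁ n₂ ((s - t) * α) ((s - t) * β) (γ s))
    (hd : ∃ᶠ s in 𝓝 t, IsDeveloped P Λ γ z u s) : ∀ᶠ s in 𝓝 t, IsDeveloped P Λ γ z u s := by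
  obtain ⟨s₀, ⟨F, hF, g, hg, hd⟩, hs₀⟩ :=
    (hd.and_eventually (eventually_eventually_nhds.2 hγ)).exists
  have hd' := hd.and_eventually (hs₀.filter_mono nhdsWithin_le_nhds)
  obtain ⟨s₁, ⟨g1, h1⟩, hne1⟩ := (hd'.and_eventually self_mem_nhdsWithin).exists
  have hne1 : s₁ ≠ s₀ := hne1
  obtain ⟨s₂, ⟨g2, h2⟩, hne2⟩ := (hd'.and_eventually
    ((eventually_ne_nhds hne1.symm).filter_mono nhdsWithin_le_nhds)).exists
  rcases h1.eq_or_eq F hF g1.1 with e | e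
  · exact eventually_of_onHinge h hγ e hg hne2.symm h1 h2 g1 g2
  -- The placed face is the second side; exchanging the sides reverses the normal coordinate.
  · refine eventually_of_onHinge (α := α) (β := -β) h.symm ?_ e hg hne2.symm ?_ ?_ g1 g2
    · filter_upwards [hγ] with s hs
      simpa using hs.symm
    · simpa using h1.symm
    · simpa using h2.symm

/-- Two geodesics which agree near a point where they are on a hinge agree around that point. -/
theorem eventuallyEq_of_onHinge {P : PolyhedralSurface} {γ γ' : ℝ → E3} {p : E3}
    {F₁ F₂ : Set E3} {τ n₁ n₂ : E3} {t α β α' β' : ℝ} (h : IsHinge P p F₁ F₂ τ n₁ n₂)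
    (hγ : ∀ᶠ s in 𝓝 t, OnHinge P p F₁ F₂ τ n₁ n₂ ((s - t) * α) ((s - t) * β) (γ s))
    (hγ' : ∀ᶠ s in 𝓝 t, OnHinge P p F₁ F₂ τ n₁ n₂ ((s - t) * α') ((s - t) * β') (γ' s))
    (hd : ∃ᶠ s in 𝓝[≠] t, γ s = γ' s) : γ =ᶠ[𝓝 t] γ' := by
  obtain ⟨s, ⟨e, h1, h2⟩, hne⟩ := ((hd.and_eventually
    ((hγ.and hγ').filter_mono nhdsWithin_le_nhds)).and_eventually self_mem_nhdsWithin).exists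
  rw [h1.eq_hingePoint, h2.eq_hingePoint] at e
  obtain ⟨e1, e2⟩ := h.hingePoint_inj e
  have hne' : s - t ≠ 0 := sub_ne_zero.2 hne
  obtain rfl := mul_left_cancel₀ hne' e1
  obtain rfl := mul_left_cancel₀ hne' e2
  filter_upwards [hγ, hγ'] with s hs hs'
  rw [hs.eq_hingePoint, hs'.eq_hingePoint]

/-! ### Half-turns and the general argument -/

/-- A symmetry of order two of the surface which fixes no vertex. -/
structure IsHalfTurn (P : PolyhedralSurface) (R : E3 ≃ₗᵢ[ℝ] E3) : Prop where
  involutive : ∀ x, R (R x) = x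
  map_face : ∀ F ∈ P.faces, R '' F ∈ P.faces
  map_vertex : ∀ v ∈ P.vertices, R v ∈ P.vertices
  ne_self : ∀ v ∈ P.vertices, R v ≠ v

/-- A surface which is locally two half-planes joined along a line away from its vertices, whose
faces are tiles of a lattice, and which has a half-turn around every point of a face that is half a
lattice vector away from a corner. -/
structure IsRollable (P : PolyhedralSurface) (ℓ : ℝ) : Prop where
  pos : 0 < ℓ
  finite : P.faces.Finite
  closed : ∀ F ∈ P.faces, IsClosed F
  exists_hinge : ∀ p ∈ P.carrier, p ∉ P.vertices → ∃ F₁ F₂ τ n₁ n₂, IsHinge P p F₁ F₂ τ n₁ n₂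
  exists_lattice : ∀ F ∈ P.faces, ∃ (g : E3 →ᵃⁱ[ℝ] E3) (Λ : AddSubgroup E3), MinNorm Λ ℓ ∧
    ∀ v ∈ P.vertices ∩ F, g v ∈ Λ
  exists_halfTurn : ∀ F ∈ P.faces, ∀ (g : E3 →ᵃⁱ[ℝ] E3) (Λ : AddSubgroup E3), MinNorm Λ ℓ →
    (∀ v ∈ P.vertices ∩ F, g v ∈ Λ) → ∀ m ∈ F, m ∉ P.vertices → g m + g m ∈ Λ →
    ∃ (R : E3 ≃ₗᵢ[ℝ] E3) (F₁ F₂ : Set E3) (τ n₁ n₂ : E3), IsHalfTurn P R ∧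
      IsHinge P m F₁ F₂ τ n₁ n₂ ∧ R m = m ∧ R τ = -τ ∧ R n₁ = n₂

/-- Lying in the closed face and on the developed line is a closed condition on `(γ s, s)`, so it
passes to the limit `s → t`. -/
theorem IsDeveloped.exists_face {P : PolyhedralSurface} (hcl : ∀ F ∈ P.faces, IsClosed F)
    {Λ : AddSubgroup E3} {γ : ℝ → E3} {z u : E3} {t : ℝ} (h : IsDeveloped P Λ γ z u t)
    (hγ : ContinuousAt γ t) :
    ∃ F ∈ P.faces, ∃ g : E3 →ᵃⁱ[ℝ] E3, (∀ v ∈ P.vertices ∩ F, g v ∈ Λ) ∧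
      γ t ∈ F ∧ g (γ t) = z + t • u := by
  obtain ⟨F, hF, g, hg, hfr⟩ := h
  refine ⟨F, hF, g, hg, ?_⟩
  have hc : IsClosed {x : E3 × ℝ | x.1 ∈ F ∧ g x.1 = z + x.2 • u} :=
    ((hcl F hF).preimage continuous_fst).inter (isClosed_eq (g.continuous.comp continuous_fst)
      (by fun_prop))
  have ht : Tendsto (fun s => (γ s, s)) (𝓝[≠] t) (𝓝 (γ t, t)) :=
    (hγ.prodMk_nhds tendsto_id).mono_left nhdsWithin_le_nhds
  exact hc.mem_of_frequently_of_tendsto hfr ht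

/-- The development of a geodesic which ends at a vertex ends at a lattice point. -/
theorem endpoint_mem_lattice {P : PolyhedralSurface} {ℓ : ℝ} (hP : IsRollable P ℓ)
    {Λ : AddSubgroup E3} (hΛ : MinNorm Λ ℓ) {γ : ℝ → E3} {z u : E3} {L : ℝ} (hL : 0 < L)
    (hγ : ContinuousOn γ (Icc 0 L)) (h : ∀ t ∈ Ioo 0 L, IsDeveloped P Λ γ z u t) {e : ℝ}
    (he : e ∈ Icc 0 L) (hv : γ e ∈ P.vertices) : z + e • u ∈ Λ := by
  -- No hinge is available at the vertex, so it is approached by interior times `t`. The placement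
  -- depends on `t`, but it is an isometry, so the lattice point `g (γ e)` is within `dist (γ e) (γ
  -- t)` of `z + t • u`.
  refine hΛ.mem_of_forall_exists hP.pos fun ε hε => ?_
  have : (𝓝[Ioo 0 L] e).NeBot := by
    rw [← mem_closure_iff_nhdsWithin_neBot, closure_Ioo hL.ne]
    exact he
  have h1 : Tendsto γ (𝓝[Ioo 0 L] e) (𝓝 (γ e)) :=
    (hγ e he).mono_left (nhdsWithin_mono _ Ioo_subset_Icc_self)
  have h2 : Tendsto (fun t => dist (γ e) (γ t) + dist (z + t • u) (z + e • u)) (𝓝[Ioo 0 L] e)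
      (𝓝 (dist (γ e) (γ e) + dist (z + e • u) (z + e • u))) := by
    refine (tendsto_const_nhds.dist h1).add (Tendsto.mono_left ?_ nhdsWithin_le_nhds)
    exact Continuous.tendsto (by fun_prop) e
  rw [dist_self, dist_self, add_zero] at h2
  obtain ⟨t, ⟨ht1, ht2⟩, ht⟩ := (((h1.eventually (eventually_mem_face hP.finite hP.closed _)).and
    (h2.eventually (gt_mem_nhds hε))).and self_mem_nhdsWithin).exists
  have hγt : ContinuousAt γ t := hγ.continuousAt (Icc_mem_nhds ht.1 ht.2)
  obtain ⟨F, hF, g, hg, htF, hgt⟩ := (h t ht).exists_face hP.closed hγt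
  refine ⟨g (γ e), hg _ ⟨hv, ht1 F hF htF⟩, (dist_triangle _ (g (γ t)) _).trans_lt ?_⟩
  rw [g.dist_map, hgt]
  exact ht2

namespace IsRollable

variable {P : PolyhedralSurface} {ℓ : ℝ}

theorem exists_onHinge (hP : IsRollable P ℓ) {γ : ℝ → E3} {L : ℝ} {p q : E3}
    (h : P.IsSaddleConnection γ L p q) {t : ℝ} (ht : t ∈ Ioo 0 L) :
    ∃ F₁ F₂ τ n₁ n₂ α β, IsHinge P (γ t) F₁ F₂ τ n₁ n₂ ∧ ∀ᶠ s in 𝓝 t,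
      OnHinge P (γ t) F₁ F₂ τ n₁ n₂ ((s - t) * α) ((s - t) * β) (γ s) := by
  obtain ⟨F₁, F₂, τ, n₁, n₂, hh⟩ := hP.exists_hinge _
    (h.mem_carrier t (Ioo_subset_Icc_self ht)) (h.not_vertex t ht)
  obtain ⟨α, β, H⟩ := (h.straight t ht).exists_onHinge hP.finite hP.closed hh
    (h.continuousOn.continuousAt (Icc_mem_nhds ht.1 ht.2))
  exact ⟨F₁, F₂, τ, n₁, n₂, α, β, hh, H⟩

/-- The development starts here: one of the two faces at `γ t` contains `γ s` for times `s`
accumulating at `t`, with constant velocity, and its lattice placement fixes the line. -/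
theorem exists_isDeveloped (hP : IsRollable P ℓ) {γ : ℝ → E3} {L : ℝ} {p q : E3}
    (h : P.IsSaddleConnection γ L p q) {t : ℝ} (ht : t ∈ Ioo 0 L) :
    ∃ (Λ : AddSubgroup E3) (z u : E3), MinNorm Λ ℓ ∧ IsDeveloped P Λ γ z u t := by
  obtain ⟨F₁, F₂, τ, n₁, n₂, α, β, hh, H⟩ := hP.exists_onHinge h ht
  have key : ∀ F ∈ P.faces, ∀ W : E3, (∃ᶠ s in 𝓝[≠] t, γ s ∈ F ∧ γ s = γ t + (s - t) • W) →
      ∃ (Λ : AddSubgroup E3) (z u : E3), MinNorm Λ ℓ ∧ IsDeveloped P Λ γ z u t := by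
    intro F hF W hfr
    obtain ⟨g, Λ, hΛ, hg⟩ := hP.exists_lattice F hF
    refine ⟨Λ, g (γ t) - t • g.linearIsometry W, g.linearIsometry W, hΛ, F, hF, g, hg, ?_⟩
    refine hfr.mono fun s hs => ⟨hs.1, ?_⟩
    have := g.map_vadd (γ t) ((s - t) • W)
    simp only [vadd_eq_add, map_smul] at this
    rw [hs.2, add_comm, this]
    module
  have hfr : ∃ᶠ s in 𝓝[≠] t, (γ s ∈ F₁ ∧ γ s = γ t + (s - t) • (α • τ + β • n₁)) ∨
      (γ s ∈ F₂ ∧ γ s = γ t + (s - t) • (α • τ - β • n₂)) := by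
    refine ((H.filter_mono nhdsWithin_le_nhds).mono fun s hs => ?_).frequently
    rcases hs.mem_or_mem with hm | hm
    · refine Or.inl ⟨hm, (hs.left hm).trans ?_⟩
      module
    · refine Or.inr ⟨hm, (hs.right hm).trans ?_⟩
      module
  rcases frequently_or_distrib.1 hfr with h' | h'
  · exact key F₁ hh.left_mem _ h'
  · exact key F₂ hh.right_mem _ h'

/-- The midpoint of a saddle connection is half a lattice vector away from a corner of its face. -/
theorem exists_midpoint (hP : IsRollable P ℓ) {γ : ℝ → E3} {L : ℝ} {p q : E3}
    (h : P.IsSaddleConnection γ L p q) :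
    ∃ F ∈ P.faces, ∃ (g : E3 →ᵃⁱ[ℝ] E3) (Λ : AddSubgroup E3), MinNorm Λ ℓ ∧
      (∀ v ∈ P.vertices ∩ F, g v ∈ Λ) ∧ γ (L / 2) ∈ F ∧ g (γ (L / 2)) + g (γ (L / 2)) ∈ Λ := by
  have hL := h.pos
  have hmid : L / 2 ∈ Ioo 0 L := ⟨by linarith, by linarith⟩
  obtain ⟨Λ, z, u, hΛ, h0⟩ := hP.exists_isDeveloped h hmid
  have hdev := forall_Ioo_of_frequently (Q := IsDeveloped P Λ γ z u) (fun t ht hfr => by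
    obtain ⟨F₁, F₂, τ, n₁, n₂, α, β, hh, H⟩ := hP.exists_onHinge h ht
    exact IsDeveloped.eventually_of_frequently hh H hfr) hmid h0
  have m0 := endpoint_mem_lattice hP hΛ hL h.continuousOn hdev
    (left_mem_Icc.2 hL.le) (h.start_eq ▸ h.start_mem)
  have mL := endpoint_mem_lattice hP hΛ hL h.continuousOn hdev
    (right_mem_Icc.2 hL.le) (h.end_eq ▸ h.end_mem)
  obtain ⟨F, hF, g, hg, hmem, hgm⟩ := h0.exists_face hP.closed
    (h.continuousOn.continuousAt (Icc_mem_nhds hmid.1 hmid.2))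
  refine ⟨F, hF, g, Λ, hΛ, hg, hmem, ?_⟩
  -- Twice the midpoint of the developed segment is the sum of its endpoints.
  convert Λ.add_mem m0 mL using 1
  rw [hgm]
  module

end IsRollable

theorem IsHalfTurn.image_carrier {P : PolyhedralSurface} {R : E3 ≃ₗᵢ[ℝ] E3} (hR : IsHalfTurn P R)
    {x : E3} (hx : x ∈ P.carrier) : R x ∈ P.carrier := by
  obtain ⟨F, hF, hxF⟩ := hx
  exact ⟨R '' F, hR.map_face F hF, mem_image_of_mem R hxF⟩

theorem IsHalfTurn.isFlatChart {P : PolyhedralSurface} {R : E3 ≃ₗᵢ[ℝ] E3} (hR : IsHalfTurn P R)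
    {U : Set E3} {φ : E3 → E2} (h : P.IsFlatChart U φ) : P.IsFlatChart (R ⁻¹' U) (φ ∘ R) where
  isOpen := h.isOpen.preimage R.continuous
  not_vertex v hv hvU := h.not_vertex (R v) (hR.map_vertex v hv) hvU
  injOn x hx y hy e := R.injective
    (h.injOn ⟨hx.1, hR.image_carrier hx.2⟩ ⟨hy.1, hR.image_carrier hy.2⟩ e)
  dist_eq F hF x hx y hy := by
    have := h.dist_eq _ (hR.map_face F hF) (R x) ⟨hx.1, mem_image_of_mem R hx.2⟩ (R y)
      ⟨hy.1, mem_image_of_mem R hy.2⟩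
    rw [R.dist_map] at this
    exact this

/-- A half-turn takes a saddle connection to a saddle connection, here with reversed direction. -/
theorem IsHalfTurn.isSaddleConnection {P : PolyhedralSurface} {R : E3 ≃ₗᵢ[ℝ] E3}
    (hR : IsHalfTurn P R) {γ : ℝ → E3} {L : ℝ} {p q : E3} (h : P.IsSaddleConnection γ L p q) :
    P.IsSaddleConnection (fun s => R (γ (L - s))) L (R q) (R p) where
  pos := h.pos
  start_mem := hR.map_vertex _ h.end_mem
  end_mem := hR.map_vertex _ h.start_mem
  continuousOn := R.continuous.comp_continuousOn (h.continuousOn.comp (by fun_prop)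
    fun s hs => ⟨by linarith [hs.2], by linarith [hs.1]⟩)
  mem_carrier t ht := hR.image_carrier (h.mem_carrier _ ⟨by linarith [ht.2], by linarith [ht.1]⟩)
  start_eq := by rw [sub_zero, h.end_eq]
  end_eq := by rw [sub_self, h.start_eq]
  not_vertex t ht hv := by
    have := hR.map_vertex _ hv
    rw [hR.involutive] at this
    exact h.not_vertex (L - t) ⟨by linarith [ht.2], by linarith [ht.1]⟩ this
  straight t ht := by
    obtain ⟨U, φ, hφ, u, hu, ε, hε, H⟩ :=
      h.straight (L - t) ⟨by linarith [ht.2], by linarith [ht.1]⟩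
    -- As `R` is an involution, the pulled-back chart reads the new path as the old one at time `L -
    -- s`, whence the direction `-u`.
    refine ⟨R ⁻¹' U, φ ∘ R, hR.isFlatChart hφ, -u, by rw [norm_neg, hu], ε, hε, fun s hs => ?_⟩
    obtain ⟨h1, h2⟩ := H (L - s) ⟨by linarith [hs.2], by linarith [hs.1]⟩
    refine ⟨⟨?_, hR.image_carrier h1.2⟩, ?_⟩
    · rw [mem_preimage, hR.involutive]
      exact h1.1
    · simp only [Function.comp_apply, hR.involutive, h2]
      module

/-- There are no closed saddle connections on a rollable surface: the half-turn around the midpoint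
of a saddle connection exchanges its endpoints. -/
theorem IsRollable.not_hasClosedSaddleConnection {P : PolyhedralSurface} {ℓ : ℝ}
    (hP : IsRollable P ℓ) : ¬ P.HasClosedSaddleConnection := by
  rintro ⟨γ, L, v, h⟩
  have hL := h.pos
  have hmid : L / 2 ∈ Ioo 0 L := ⟨by linarith, by linarith⟩
  obtain ⟨F, hF, g, Λ, hΛ, hg, hmem, hgm⟩ := hP.exists_midpoint h
  obtain ⟨R, F₁, F₂, τ, n₁, n₂, hR, hh, Rm, Rτ, Rn⟩ :=
    hP.exists_halfTurn F hF g Λ hΛ hg _ hmem (h.not_vertex _ hmid) hgm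
  have h' := hR.isSaddleConnection h
  have hcont : ∀ t ∈ Ioo 0 L, ContinuousAt γ t ∧ ContinuousAt (fun s => R (γ (L - s))) t :=
    fun t ht => ⟨h.continuousOn.continuousAt (Icc_mem_nhds ht.1 ht.2),
      h'.continuousOn.continuousAt (Icc_mem_nhds ht.1 ht.2)⟩
  -- In hinge coordinates at the midpoint `R` is `(x, y) ↦ (-x, -y)`: it negates `τ` and exchanges
  -- the normals. Reversing time about `L / 2` has the same effect on the coordinates of `γ`.
  have h0 : γ =ᶠ[𝓝 (L / 2)] fun s => R (γ (L - s)) := by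
    obtain ⟨α, β, H⟩ := (h.straight _ hmid).exists_onHinge hP.finite hP.closed hh (hcont _ hmid).1
    have ht : Tendsto (fun s => L - s) (𝓝 (L / 2)) (𝓝 (L / 2)) := by
      have : Tendsto (fun s : ℝ => L - s) (𝓝 (L / 2)) (𝓝 (L - L / 2)) :=
        Continuous.tendsto (by fun_prop) _
      rwa [sub_half] at this
    filter_upwards [H, ht.eventually H] with s hs hs'
    have Rn' : R n₂ = n₁ := by rw [← Rn, hR.involutive]
    have e1 : (L - s - L / 2) * α = -((s - L / 2) * α) := by ring
    have e2 : (L - s - L / 2) * β = -((s - L / 2) * β) := by ring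
    rw [hs.eq_hingePoint, hs'.eq_hingePoint, e1, e2]
    simp only [hingePoint, map_add, map_smul, Rm, Rτ, Rn, Rn', neg_neg]
    module
  have hall := forall_Ioo_of_frequently (Q := fun t => γ =ᶠ[𝓝 t] fun s => R (γ (L - s)))
    (fun t ht hfr => by
      have hpt : γ t = R (γ (L - t)) := by
        have hc : IsClosed {x : E3 × E3 | x.1 = x.2} := isClosed_diagonal
        exact hc.mem_of_frequently_of_tendsto (hfr.mono fun s hs => hs.self_of_nhds)
          ((hcont t ht).1.prodMk_nhds (hcont t ht).2)
      obtain ⟨G₁, G₂, τ', m₁, m₂, α, β, hh', H⟩ := hP.exists_onHinge h ht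
      have hh'' := hh'
      rw [hpt] at hh''
      obtain ⟨α', β', H'⟩ := (h'.straight t ht).exists_onHinge hP.finite hP.closed hh''
        (hcont t ht).2
      simp only [← hpt] at H'
      -- Agreement at `t` itself says nothing about velocities, so a coincidence at some time other
      -- than `t` is needed.
      have hfr' : ∃ᶠ s in 𝓝[≠] t, γ s = R (γ (L - s)) := by
        rw [frequently_iff]
        intro U hU
        obtain ⟨V, hV, htV, hVU⟩ := mem_nhdsWithin.1 hU
        obtain ⟨s, hs, hsV⟩ := (hfr.and_eventually (hV.mem_nhds htV)).exists
        by_cases hst : s = t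
        · subst hst
          obtain ⟨s', ⟨hs1, hs2⟩, hs3⟩ := (((hs.and (hV.mem_nhds hsV)).filter_mono
            (nhdsWithin_le_nhds (s := {s}ᶜ))).and self_mem_nhdsWithin).exists
          exact ⟨s', hVU ⟨hs2, hs3⟩, hs1⟩
        · exact ⟨s, hVU ⟨hsV, hst⟩, hs.self_of_nhds⟩
      exact eventually_eventually_nhds.2 (eventuallyEq_of_onHinge hh' H H' hfr')) hmid h0
  have hne : (𝓝[Ioo 0 L] (0 : ℝ)).NeBot := by
    rw [← mem_closure_iff_nhdsWithin_neBot, closure_Ioo hL.ne]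
    exact left_mem_Icc.2 hL.le
  have l1 := (h.continuousOn 0 (left_mem_Icc.2 hL.le)).mono_left
    (nhdsWithin_mono _ Ioo_subset_Icc_self)
  have l2 := (h'.continuousOn 0 (left_mem_Icc.2 hL.le)).mono_left
    (nhdsWithin_mono _ Ioo_subset_Icc_self)
  -- Letting `t` tend to `0` in `γ t = R (γ (L - t))` gives `v = R v`.
  have e := tendsto_nhds_unique_of_eventuallyEq l1 l2
    (eventually_nhdsWithin_of_forall fun t ht => (hall t ht).self_of_nhds)
  simp only [sub_zero, h.start_eq, h.end_eq] at e
  exact hR.ne_self v h.start_mem e.symm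

/-! ### Lattices with an orthogonal or a hexagonal basis -/

theorem norm_sq_smul_add_smul {g h : E3} {ℓ c : ℝ} (hg : inner ℝ g g = ℓ ^ 2)
    (hh : inner ℝ h h = ℓ ^ 2) (hgh : inner ℝ g h = c * ℓ ^ 2) (x y : ℝ) :
    ‖x • g + y • h‖ ^ 2 = (x ^ 2 + 2 * c * (x * y) + y ^ 2) * ℓ ^ 2 := by
  rw [← real_inner_self_eq_norm_sq]
  simp only [inner_add_left, inner_add_right, inner_smul_left, inner_smul_right, hg, hh, hgh,
    real_inner_comm g h, conj_trivial]
  ring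

/-- Both `m² + n²` and `m² + m n + n²` are positive definite with integer values, hence at least `1`
away from the origin. -/
theorem minNorm_closure_pair {g h : E3} {ℓ c : ℝ} (hc : c = 0 ∨ c = 1 / 2)
    (hg : inner ℝ g g = ℓ ^ 2) (hh : inner ℝ h h = ℓ ^ 2) (hgh : inner ℝ g h = c * ℓ ^ 2) :
    MinNorm (AddSubgroup.closure {g, h}) ℓ := by
  intro w hw hw0
  obtain ⟨m, n, rfl⟩ := AddSubgroup.mem_closure_pair.1 hw
  have e : m • g + n • h = (m : ℝ) • g + (n : ℝ) • h := by
    rw [Int.cast_smul_eq_zsmul, Int.cast_smul_eq_zsmul]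
  rw [e] at hw0 ⊢
  have h1 := norm_sq_smul_add_smul hg hh hgh m n
  have h2 : (1 : ℝ) ≤ (m : ℝ) ^ 2 + 2 * c * (m * n) + (n : ℝ) ^ 2 := by
    have hne : m ≠ 0 ∨ n ≠ 0 := by
      by_contra! hcon
      simp [hcon.1, hcon.2] at hw0
    rcases hc with rfl | rfl
    · have : 1 ≤ m ^ 2 + n ^ 2 := by
        rcases hne with h | h
        · have := sq_pos_of_ne_zero h
          nlinarith [sq_nonneg n]
        · have := sq_pos_of_ne_zero h
          nlinarith [sq_nonneg m]
      have : (1 : ℝ) ≤ (m : ℝ) ^ 2 + (n : ℝ) ^ 2 := by exact_mod_cast this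
      linarith
    · have : 1 ≤ m ^ 2 + m * n + n ^ 2 := by
        have : 0 < m ^ 2 + m * n + n ^ 2 := by
          rcases hne with h | h
          · have := sq_pos_of_ne_zero h
            nlinarith [sq_nonneg (m + 2 * n)]
          · have := sq_pos_of_ne_zero h
            nlinarith [sq_nonneg (2 * m + n)]
        linarith
      have : (1 : ℝ) ≤ (m : ℝ) ^ 2 + m * n + (n : ℝ) ^ 2 := by exact_mod_cast this
      linarith
  refine le_of_sq_le_sq ?_ (norm_nonneg _)
  rw [h1]
  nlinarith [sq_nonneg ℓ]

/-- Rounding both coordinates leaves a remainder in `Λ` with coordinates at most `1 / 2` in absolute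
value. Its squared norm is at most `3 / 4 * ℓ ^ 2`, so the remainder vanishes. Thus `Λ` contains no
points of the plane of `g` and `h` beyond the lattice they span. -/
theorem MinNorm.exists_int {Λ : AddSubgroup E3} {g h : E3} {ℓ c : ℝ} (hℓ : 0 < ℓ)
    (hc : c = 0 ∨ c = 1 / 2) (hΛ : MinNorm Λ ℓ) (gm : g ∈ Λ) (hm : h ∈ Λ)
    (hg : inner ℝ g g = ℓ ^ 2) (hh : inner ℝ h h = ℓ ^ 2) (hgh : inner ℝ g h = c * ℓ ^ 2)
    {X Y : ℝ} (hXY : X • g + Y • h ∈ Λ) : (∃ m : ℤ, X = m) ∧ ∃ n : ℤ, Y = n := by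
  set x := X - round X with hx
  set y := Y - round Y with hy
  have ax : |x| ≤ 1 / 2 := abs_sub_round X
  have ay : |y| ≤ 1 / 2 := abs_sub_round Y
  rw [abs_le] at ax ay
  have hw : x • g + y • h ∈ Λ := by
    have e : x • g + y • h = (X • g + Y • h) - (round X • g + round Y • h) := by
      rw [hx, hy, ← Int.cast_smul_eq_zsmul ℝ (round X), ← Int.cast_smul_eq_zsmul ℝ (round Y)]
      module
    rw [e]
    exact Λ.sub_mem hXY (Λ.add_mem (Λ.zsmul_mem gm _) (Λ.zsmul_mem hm _))
  have h1 := norm_sq_smul_add_smul hg hh hgh x y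
  have hℓ2 : 0 < ℓ ^ 2 := by positivity
  have hx2 : x ^ 2 ≤ 1 / 4 := by nlinarith
  have hy2 : y ^ 2 ≤ 1 / 4 := by nlinarith
  have hq : x ^ 2 + 2 * c * (x * y) + y ^ 2 < 1 := by
    rcases hc with rfl | rfl <;> nlinarith [sq_nonneg (x - y)]
  have h0 : x • g + y • h = 0 := by
    by_contra hne
    have := hΛ _ hw hne
    have : ℓ ^ 2 ≤ ‖x • g + y • h‖ ^ 2 := by gcongr
    rw [h1] at this
    nlinarith
  rw [h0, norm_zero] at h1
  have h2 : x ^ 2 + 2 * c * (x * y) + y ^ 2 = 0 := by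
    have : (x ^ 2 + 2 * c * (x * y) + y ^ 2) * ℓ ^ 2 = 0 := by rw [← h1]; ring
    exact (mul_eq_zero.1 this).resolve_right hℓ2.ne'
  have h3 : x ^ 2 = 0 ∧ y ^ 2 = 0 := by
    have a := sq_nonneg x
    have b := sq_nonneg y
    rcases hc with rfl | rfl
    · constructor <;> linarith
    · constructor <;> nlinarith [sq_nonneg (x + y)]
  refine ⟨⟨round X, ?_⟩, round Y, ?_⟩
  · linarith [pow_eq_zero_iff (two_ne_zero) |>.1 h3.1]
  · linarith [pow_eq_zero_iff (two_ne_zero) |>.1 h3.2]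

theorem affineIsometry_smul_add_smul (g : E3 →ᵃⁱ[ℝ] E3) (a b c : E3) (x y : ℝ) :
    g (a + x • (b - a) + y • (c - a)) = g a + x • (g b - g a) + y • (g c - g a) := by
  have h1 := g.map_vadd a (x • (b - a) + y • (c - a))
  have h2 := g.map_vsub b a
  have h3 := g.map_vsub c a
  simp only [vadd_eq_add, vsub_eq_sub, map_add, map_smul] at h1 h2 h3
  rw [add_assoc, add_comm a, h1, h2, h3]
  abel

theorem affineIsometry_inner_sub (g : E3 →ᵃⁱ[ℝ] E3) (a b c : E3) :
    inner ℝ (g b - g a) (g c - g a) = inner ℝ (b - a) (c - a) := by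
  have h2 := g.map_vsub b a
  have h3 := g.map_vsub c a
  simp only [vsub_eq_sub] at h2 h3
  rw [← h2, ← h3, LinearIsometry.inner_map_map]

/-- A tile with adjacent sides `b - a`, `c - a` whose corners are lattice points: coordinates of
half-lattice points of the tile are half-integers. -/
theorem MinNorm.exists_half_int {Λ : AddSubgroup E3} {ℓ k : ℝ} (hℓ : 0 < ℓ)
    (hk : k = 0 ∨ k = 1 / 2) (hΛ : MinNorm Λ ℓ) {g : E3 →ᵃⁱ[ℝ] E3} {a b c : E3} (ha : g a ∈ Λ)
    (hb : g b ∈ Λ) (hc : g c ∈ Λ) (hbb : inner ℝ (b - a) (b - a) = ℓ ^ 2)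
    (hcc : inner ℝ (c - a) (c - a) = ℓ ^ 2) (hbc : inner ℝ (b - a) (c - a) = k * ℓ ^ 2) {x y : ℝ}
    (h : g (a + x • (b - a) + y • (c - a)) + g (a + x • (b - a) + y • (c - a)) ∈ Λ) :
    (∃ m : ℤ, 2 * x = m) ∧ ∃ n : ℤ, 2 * y = n := by
  refine hΛ.exists_int hℓ hk (Λ.sub_mem hb ha) (Λ.sub_mem hc ha)
    ((affineIsometry_inner_sub g a b b).trans hbb) ((affineIsometry_inner_sub g a c c).trans hcc)
    ((affineIsometry_inner_sub g a b c).trans hbc) ?_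
  rw [affineIsometry_smul_add_smul] at h
  convert Λ.sub_mem h (Λ.add_mem ha ha) using 1
  module

/-- The translation of space which takes `a` to the origin. -/
noncomputable def translationToOrigin (a : E3) : E3 →ᵃⁱ[ℝ] E3 :=
  (AffineIsometryEquiv.vaddConst ℝ a).symm.toAffineIsometry

theorem translationToOrigin_apply (a x : E3) : translationToOrigin a x = x - a := rfl

/-! ### Surfaces made of equilateral triangles -/

/-- Barycentric coordinates, in which all later questions about triangular faces are settled. -/
theorem mem_convexHull_triangle {a b c q : E3} : q ∈ convexHull ℝ {a, b, c} ↔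
    ∃ x y z : ℝ, 0 ≤ x ∧ 0 ≤ y ∧ 0 ≤ z ∧ x + y + z = 1 ∧ x • a + y • b + z • c = q := by
  constructor
  · rw [convexHull_insert (by simp), convexHull_pair, mem_convexJoin]
    rintro ⟨a', rfl, d, ⟨s, t, hs, ht, hst, rfl⟩, ⟨s', t', hs', ht', hst', rfl⟩⟩
    refine ⟨s', t' * s, t' * t, hs', by positivity, by positivity, ?_, ?_⟩
    · linear_combination hst' + t' * hst
    · module
  · rintro ⟨x, y, z, hx, hy, hz, h, rfl⟩
    have hs : ∀ i ∈ (Finset.univ : Finset (Fin 3)), ![a, b, c] i ∈ convexHull ℝ {a, b, c} := by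
      intro i _
      refine subset_convexHull ℝ _ ?_
      fin_cases i <;> simp
    have := (convex_convexHull ℝ {a, b, c}).sum_mem (t := Finset.univ) (w := ![x, y, z])
      (z := ![a, b, c]) (fun i _ => by fin_cases i <;> simpa)
      (by simpa [Fin.sum_univ_three] using h) hs
    simpa [Fin.sum_univ_three] using this

/-- A finite set `V` of points on a sphere around the origin, such that the half-turn in the
midpoint of any two points of `V` at minimal distance preserves `V` and fixes no point of it. -/
structure IsDeltahedral (V : Set E3) (r κ ℓ : ℝ) : Prop where
  finite : V.Finite
  pos : 0 < ℓ
  sq_eq : ℓ ^ 2 = 2 * (r - κ)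
  add_pos : 0 < r + κ
  inner_self : ∀ v ∈ V, inner ℝ v v = r
  inner_le : ∀ v ∈ V, ∀ w ∈ V, v ≠ w → inner ℝ v w ≤ κ
  reflection_mem : ∀ a ∈ V, ∀ b ∈ V, inner ℝ a b = κ → ∀ v ∈ V, (ℝ ∙ (a + b)).reflection v ∈ V
  ne_smul : ∀ a ∈ V, ∀ b ∈ V, inner ℝ a b = κ → ∀ v ∈ V, ∀ k : ℝ, v ≠ k • (a + b)

/-- The points `a`, `b`, `c` of `V` are the corners of a face. -/
structure IsTriangle (V : Set E3) (κ : ℝ) (a b c : E3) : Prop where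
  fst_mem : a ∈ V
  snd_mem : b ∈ V
  trd_mem : c ∈ V
  inner_fst_snd : inner ℝ a b = κ
  inner_snd_trd : inner ℝ b c = κ
  inner_trd_fst : inner ℝ c a = κ

theorem IsTriangle.rotate {V : Set E3} {κ : ℝ} {a b c : E3} (h : IsTriangle V κ a b c) :
    IsTriangle V κ b c a :=
  ⟨h.snd_mem, h.trd_mem, h.fst_mem, h.inner_snd_trd, h.inner_trd_fst, h.inner_fst_snd⟩

theorem E3.inner_eq (v w : E3) : inner ℝ v w = v 0 * w 0 + v 1 * w 1 + v 2 * w 2 := by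
  simp [PiLp.inner_apply, Fin.sum_univ_three, mul_comm]

/-- The orthogonal complement of a plane is a line. -/
theorem E3.exists_eq_smul {a b v w : E3}
    (hab : inner ℝ a a * inner ℝ b b - inner ℝ a b ^ 2 ≠ (0 : ℝ)) (hv : v ≠ 0)
    (hav : inner ℝ a v = 0) (hbv : inner ℝ b v = 0) (haw : inner ℝ a w = 0)
    (hbw : inner ℝ b w = 0) : ∃ k : ℝ, w = k • v := by
  have hvv : inner ℝ v v ≠ (0 : ℝ) := inner_self_ne_zero.2 hv
  simp only [E3.inner_eq] at *
  -- `(x, y, z)` is the cross product `a × b`, nonzero by the Gram condition. A vector `u`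
  -- orthogonal to `a` and `b` satisfies `‖a × b‖² u = ⟪a × b, u⟫ (a × b)`.
  set x := a 1 * b 2 - a 2 * b 1 with hx
  set y := a 2 * b 0 - a 0 * b 2 with hy
  set z := a 0 * b 1 - a 1 * b 0 with hz
  have hN : x ^ 2 + y ^ 2 + z ^ 2 ≠ 0 := by
    rw [hx, hy, hz]
    convert hab using 1
    ring
  have line : ∀ u : E3, a 0 * u 0 + a 1 * u 1 + a 2 * u 2 = 0 →
      b 0 * u 0 + b 1 * u 1 + b 2 * u 2 = 0 →
      (x ^ 2 + y ^ 2 + z ^ 2) * u 0 = (x * u 0 + y * u 1 + z * u 2) * x ∧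
      (x ^ 2 + y ^ 2 + z ^ 2) * u 1 = (x * u 0 + y * u 1 + z * u 2) * y ∧
      (x ^ 2 + y ^ 2 + z ^ 2) * u 2 = (x * u 0 + y * u 1 + z * u 2) * z := by
    intro u h1 h2
    rw [hx, hy, hz]
    refine ⟨?_, ?_, ?_⟩
    · linear_combination (y * b 2 - z * b 1) * h1 * (-1) + (y * a 2 - z * a 1) * h2
    · linear_combination (z * b 0 - x * b 2) * h1 * (-1) + (z * a 0 - x * a 2) * h2
    · linear_combination (x * b 1 - y * b 0) * h1 * (-1) + (x * a 1 - y * a 0) * h2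
  obtain ⟨v0, v1, v2⟩ := line v hav hbv
  obtain ⟨w0, w1, w2⟩ := line w haw hbw
  set s := x * v 0 + y * v 1 + z * v 2
  set t := x * w 0 + y * w 1 + z * w 2
  have hs : s ≠ 0 := by
    intro hs
    rw [hs, zero_mul] at v0 v1 v2
    refine hvv ?_
    rw [(mul_eq_zero.1 v0).resolve_left hN, (mul_eq_zero.1 v1).resolve_left hN,
      (mul_eq_zero.1 v2).resolve_left hN]
    ring
  refine ⟨t / s, ?_⟩
  ext i
  refine mul_left_cancel₀ hN ?_
  fin_cases i
  · simp only [PiLp.smul_apply, smul_eq_mul, Fin.zero_eta]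
    rw [w0, mul_left_comm, v0]
    field_simp
  · simp only [PiLp.smul_apply, smul_eq_mul, Fin.mk_one]
    rw [w1, mul_left_comm, v1]
    field_simp
  · simp only [PiLp.smul_apply, smul_eq_mul, Fin.reduceFinMk]
    rw [w2, mul_left_comm, v2]
    field_simp

theorem reflection_add_apply {a b : E3} {r κ : ℝ} (ha : inner ℝ a a = r) (hb : inner ℝ b b = r)
    (hab : inner ℝ a b = κ) (h : 0 < r + κ) (v : E3) : (ℝ ∙ (a + b)).reflection v =
      ((inner ℝ a v + inner ℝ b v) / (r + κ)) • (a + b) - v := by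
  have hn : ‖a + b‖ ^ 2 = 2 * (r + κ) := by
    rw [← real_inner_self_eq_norm_sq, inner_add_left, inner_add_right, inner_add_right, ha, hb,
      real_inner_comm a b, hab]
    ring
  rw [Submodule.reflection_singleton_apply, RCLike.ofReal_real_eq_id, id, hn, inner_add_left,
    ← Nat.cast_smul_eq_nsmul ℝ 2, smul_smul]
  congr 2
  simp
  field_simp

namespace IsDeltahedral

variable {V : Set E3} {r κ ℓ : ℝ}

theorem sub_pos (h : IsDeltahedral V r κ ℓ) : 0 < r - κ := by
  have := h.sq_eq
  have := h.pos
  nlinarith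

/-- On the sphere of squared radius `r`, `‖a - b‖² = 2 (r - ⟪a, b⟫)`. So `κ` is the inner product of
two adjacent vertices, and adjacency becomes an algebraic condition. -/
theorem dist_eq_iff (h : IsDeltahedral V r κ ℓ) {a b : E3} (ha : a ∈ V) (hb : b ∈ V) :
    dist a b = ℓ ↔ inner ℝ a b = κ := by
  have e : dist a b ^ 2 = 2 * (r - inner ℝ a b) := by
    rw [dist_eq_norm, ← real_inner_self_eq_norm_sq, inner_sub_left, inner_sub_right,
      inner_sub_right, h.inner_self a ha, h.inner_self b hb, real_inner_comm a b]
    ring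
  have hs := h.sq_eq
  constructor
  · intro hd
    rw [hd] at e
    linarith
  · intro hi
    rw [hi, ← hs] at e
    exact (sq_eq_sq₀ dist_nonneg h.pos.le).1 e

theorem face_iff (h : IsDeltahedral V r κ ℓ) {F : Set E3} : F ∈ (ofTriangles V ℓ).faces ↔
    ∃ a b c, IsTriangle V κ a b c ∧ F = convexHull ℝ {a, b, c} := by
  constructor
  · rintro ⟨a, ha, b, hb, c, hc, h1, h2, h3, rfl⟩
    exact ⟨a, b, c, ⟨ha, hb, hc, (h.dist_eq_iff ha hb).1 h1, (h.dist_eq_iff hb hc).1 h2,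
      (h.dist_eq_iff hc ha).1 h3⟩, rfl⟩
  · rintro ⟨a, b, c, ht, rfl⟩
    exact ⟨a, ht.fst_mem, b, ht.snd_mem, c, ht.trd_mem,
      (h.dist_eq_iff ht.fst_mem ht.snd_mem).2 ht.inner_fst_snd,
      (h.dist_eq_iff ht.snd_mem ht.trd_mem).2 ht.inner_snd_trd,
      (h.dist_eq_iff ht.trd_mem ht.fst_mem).2 ht.inner_trd_fst, rfl⟩

theorem inner_sum_self (h : IsDeltahedral V r κ ℓ) {a b c : E3} (t : IsTriangle V κ a b c) :
    inner ℝ (a + b + c) a = r + 2 * κ := by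
  rw [inner_add_left, inner_add_left, h.inner_self a t.fst_mem, real_inner_comm, t.inner_fst_snd,
    t.inner_trd_fst]
  ring

/-- The face with corners `a`, `b`, `c` is the locus on which the functional `a + b + c` is
maximal. -/
theorem inner_sum_le (h : IsDeltahedral V r κ ℓ) {a b c v : E3} (t : IsTriangle V κ a b c)
    (hv : v ∈ V) : inner ℝ (a + b + c) v ≤ r + 2 * κ ∧
      (v ∉ ({a, b, c} : Set E3) → inner ℝ (a + b + c) v < r + 2 * κ) := by
  have h2 := h.inner_sum_self t.rotate
  have h3 := h.inner_sum_self t.rotate.rotate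
  have hlt : v ∉ ({a, b, c} : Set E3) → inner ℝ (a + b + c) v < r + 2 * κ := by
    intro hv'
    simp only [mem_insert_iff, mem_singleton_iff, not_or] at hv'
    rw [inner_add_left, inner_add_left]
    have := h.inner_le a t.fst_mem v hv (Ne.symm hv'.1)
    have := h.inner_le b t.snd_mem v hv (Ne.symm hv'.2.1)
    have := h.inner_le c t.trd_mem v hv (Ne.symm hv'.2.2)
    have := h.sub_pos
    linarith
  refine ⟨?_, hlt⟩
  by_cases hv' : v ∈ ({a, b, c} : Set E3)
  · rcases hv' with rfl | rfl | rfl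
    · exact (h.inner_sum_self t).le
    · exact (by rw [show a + v + c = v + c + a by abel]; exact h2.le)
    · exact (by rw [show a + b + v = v + a + b by abel]; exact h3.le)
  · exact (hlt hv').le

theorem inner_sum_of_mem (h : IsDeltahedral V r κ ℓ) {a b c q : E3} (t : IsTriangle V κ a b c)
    (hq : q ∈ convexHull ℝ {a, b, c}) : inner ℝ (a + b + c) q = r + 2 * κ := by
  obtain ⟨x, y, z, -, -, -, hs, rfl⟩ := mem_convexHull_triangle.1 hq
  have h1 := h.inner_sum_self t
  have h2 := h.inner_sum_self t.rotate
  have h3 := h.inner_sum_self t.rotate.rotate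
  rw [show b + c + a = a + b + c by abel] at h2
  rw [show c + a + b = a + b + c by abel] at h3
  rw [inner_add_right, inner_add_right, inner_smul_right, inner_smul_right, inner_smul_right, h1,
    h2, h3]
  linear_combination (r + 2 * κ) * hs

/-- Over `V`, the functional `a + b + c` reaches its maximum only at the three corners, so a convex
combination reaching it puts no weight elsewhere. This decides which faces contain a given point. -/
theorem mem_of_weight_pos (h : IsDeltahedral V r κ ℓ) {a b c a' b' c' : E3}
    (t : IsTriangle V κ a b c) (ha' : a' ∈ V) (hb' : b' ∈ V) (hc' : c' ∈ V) {x y z : ℝ}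
    (hx : 0 < x) (hy : 0 ≤ y) (hz : 0 ≤ z) (hs : x + y + z = 1)
    (hq : x • a' + y • b' + z • c' ∈ convexHull ℝ {a, b, c}) : a' ∈ ({a, b, c} : Set E3) := by
  by_contra hcon
  have h1 := (h.inner_sum_le t ha').2 hcon
  have h2 := (h.inner_sum_le t hb').1
  have h3 := (h.inner_sum_le t hc').1
  have h4 := h.inner_sum_of_mem t hq
  rw [inner_add_right, inner_add_right, inner_smul_right, inner_smul_right, inner_smul_right] at h4
  have : (r + 2 * κ) = x * (r + 2 * κ) + y * (r + 2 * κ) + z * (r + 2 * κ) := by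
    linear_combination -(r + 2 * κ) * hs
  nlinarith [mul_lt_mul_of_pos_left h1 hx, mul_le_mul_of_nonneg_left h2 hy,
    mul_le_mul_of_nonneg_left h3 hz]

theorem vertex_mem (h : IsDeltahedral V r κ ℓ) {a b c v : E3} (t : IsTriangle V κ a b c)
    (hv : v ∈ V) (hq : v ∈ convexHull ℝ {a, b, c}) : v = a ∨ v = b ∨ v = c := by
  have := h.mem_of_weight_pos t hv hv hv one_pos le_rfl le_rfl (by norm_num) (by simpa using hq)
  simpa using this

theorem ne_of_inner (h : IsDeltahedral V r κ ℓ) {a b : E3} (ha : a ∈ V) (hab : inner ℝ a b = κ) :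
    a ≠ b := by
  rintro rfl
  have := h.sub_pos
  rw [h.inner_self a ha] at hab
  linarith

theorem reflection_apply (h : IsDeltahedral V r κ ℓ) {a b : E3} (ha : a ∈ V) (hb : b ∈ V)
    (hab : inner ℝ a b = κ) (v : E3) : (ℝ ∙ (a + b)).reflection v =
      ((inner ℝ a v + inner ℝ b v) / (r + κ)) • (a + b) - v :=
  reflection_add_apply (h.inner_self a ha) (h.inner_self b hb) hab h.add_pos v

theorem reflection_left (h : IsDeltahedral V r κ ℓ) {a b : E3} (ha : a ∈ V) (hb : b ∈ V)
    (hab : inner ℝ a b = κ) : (ℝ ∙ (a + b)).reflection a = b := by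
  rw [h.reflection_apply ha hb hab, h.inner_self a ha, real_inner_comm, hab,
    div_self h.add_pos.ne', one_smul, add_sub_cancel_left]

theorem reflection_right (h : IsDeltahedral V r κ ℓ) {a b : E3} (ha : a ∈ V) (hb : b ∈ V)
    (hab : inner ℝ a b = κ) : (ℝ ∙ (a + b)).reflection b = a := by
  have := congrArg (ℝ ∙ (a + b)).reflection (h.reflection_left ha hb hab)
  rw [Submodule.reflection_reflection] at this
  exact this.symm

end IsDeltahedral

theorem IsTriangle.swap {V : Set E3} {κ : ℝ} {a b c : E3} (h : IsTriangle V κ a b c) :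
    IsTriangle V κ b a c :=
  ⟨h.snd_mem, h.fst_mem, h.trd_mem, by rw [real_inner_comm, h.inner_fst_snd],
    by rw [real_inner_comm, h.inner_trd_fst], by rw [real_inner_comm, h.inner_snd_trd]⟩

theorem IsTriangle.exists_third {V : Set E3} {κ : ℝ} {a b a' b' c' : E3}
    (t : IsTriangle V κ a' b' c') (hne : a ≠ b) (ha : a ∈ ({a', b', c'} : Set E3))
    (hb : b ∈ ({a', b', c'} : Set E3)) :
    ∃ e, IsTriangle V κ a b e ∧ ({a', b', c'} : Set E3) = {a, b, e} := by
  have perm : ∀ u v w u' v' w' : E3, (∀ q, (q = u ∨ q = v ∨ q = w) ↔ (q = u' ∨ q = v' ∨ q = w')) →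
      ({u, v, w} : Set E3) = {u', v', w'} := fun u v w u' v' w' h => by
    ext q
    simpa using h q
  rcases ha with rfl | rfl | rfl <;> rcases hb with rfl | rfl | rfl
  · exact absurd rfl hne
  · exact ⟨c', t, rfl⟩
  · exact ⟨b', t.rotate.rotate.swap, perm _ _ _ _ _ _ fun q => by tauto⟩
  · exact ⟨c', t.swap, perm _ _ _ _ _ _ fun q => by tauto⟩
  · exact absurd rfl hne
  · exact ⟨a', t.rotate, perm _ _ _ _ _ _ fun q => by tauto⟩
  · exact ⟨b', t.rotate.rotate, perm _ _ _ _ _ _ fun q => by tauto⟩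
  · exact ⟨a', t.rotate.swap, perm _ _ _ _ _ _ fun q => by tauto⟩
  · exact absurd rfl hne

namespace IsDeltahedral

variable {V : Set E3} {r κ ℓ : ℝ}

/-- The half-turn exchanges `a` and `b`, so it carries `c` to the third corner of a face on the same
edge. The neighbouring face is thus found without listing faces. -/
theorem reflect (h : IsDeltahedral V r κ ℓ) {a b c : E3} (t : IsTriangle V κ a b c) :
    IsTriangle V κ a b ((ℝ ∙ (a + b)).reflection c) := by
  have e1 := h.reflection_left t.fst_mem t.snd_mem t.inner_fst_snd
  have e2 := h.reflection_right t.fst_mem t.snd_mem t.inner_fst_snd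
  refine ⟨t.fst_mem, t.snd_mem,
    h.reflection_mem _ t.fst_mem _ t.snd_mem t.inner_fst_snd _ t.trd_mem, t.inner_fst_snd, ?_, ?_⟩
  · have := (ℝ ∙ (a + b)).reflection.inner_map_map a c
    rw [e1] at this
    rw [this, real_inner_comm, t.inner_trd_fst]
  · have := (ℝ ∙ (a + b)).reflection.inner_map_map c b
    rw [e2] at this
    rw [this, real_inner_comm, t.inner_snd_trd]

theorem reflection_ne (h : IsDeltahedral V r κ ℓ) {a b v : E3} (ha : a ∈ V) (hb : b ∈ V)
    (hab : inner ℝ a b = κ) (hv : v ∈ V) : (ℝ ∙ (a + b)).reflection v ≠ v := by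
  intro e
  obtain ⟨k, hk⟩ := Submodule.mem_span_singleton.1 ((Submodule.reflection_eq_self_iff _).1 e)
  exact h.ne_smul a ha b hb hab v hv k hk.symm

/-- An edge belongs to exactly two faces. -/
theorem eq_or_eq_reflection (h : IsDeltahedral V r κ ℓ) {a b c e : E3} (t : IsTriangle V κ a b c)
    (t' : IsTriangle V κ a b e) : e = c ∨ e = (ℝ ∙ (a + b)).reflection c := by
  have td := h.reflect t
  set d := (ℝ ∙ (a + b)).reflection c
  have hdc : d - c ≠ 0 :=
    sub_ne_zero.2 (h.reflection_ne t.fst_mem t.snd_mem t.inner_fst_snd t.trd_mem)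
  have hgram : inner ℝ a a * inner ℝ b b - inner ℝ a b ^ 2 ≠ (0 : ℝ) := by
    rw [h.inner_self a t.fst_mem, h.inner_self b t.snd_mem, t.inner_fst_snd]
    have := mul_pos h.sub_pos h.add_pos
    nlinarith
  have ia : ∀ {f}, IsTriangle V κ a b f → inner ℝ a (f - c) = (0 : ℝ) := fun tf => by
    rw [inner_sub_right, real_inner_comm, tf.inner_trd_fst, real_inner_comm, t.inner_trd_fst,
      sub_self]
  have ib : ∀ {f}, IsTriangle V κ a b f → inner ℝ b (f - c) = (0 : ℝ) := fun tf => by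
    rw [inner_sub_right, tf.inner_snd_trd, t.inner_snd_trd, sub_self]
  -- Third corners on the edge have the same inner products with `a` and `b`, so they lie on a line
  -- orthogonal to both. That line meets the sphere only at `c` and `d`, that is at `k = 0` and `k =
  -- 1`.
  obtain ⟨k, hk⟩ := E3.exists_eq_smul hgram hdc (ia td) (ib td) (ia t') (ib t')
  have i0 : inner ℝ (d - c) (d - c) ≠ (0 : ℝ) := inner_self_ne_zero.2 hdc
  have i1 : ∀ s : ℝ, inner ℝ (c + s • (d - c)) (c + s • (d - c)) =
      r + 2 * s * inner ℝ c (d - c) + s ^ 2 * inner ℝ (d - c) (d - c) := by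
    intro s
    rw [inner_add_left, inner_add_right, inner_add_right, inner_smul_left, inner_smul_right,
      inner_smul_right, inner_smul_left, h.inner_self c t.trd_mem, real_inner_comm c (d - c)]
    simp only [conj_trivial]
    ring
  have e1 := i1 1
  rw [one_smul, add_sub_cancel, h.inner_self d td.trd_mem] at e1
  have ek := i1 k
  rw [← hk, add_sub_cancel, h.inner_self e t'.trd_mem] at ek
  have hkk : (k * (k - 1)) * inner ℝ (d - c) (d - c) = 0 := by
    linear_combination k * e1 - ek
  rcases mul_eq_zero.1 ((mul_eq_zero.1 hkk).resolve_right i0) with hk0 | hk0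
  · left
    rw [hk0, zero_smul] at hk
    exact sub_eq_zero.1 hk
  · right
    rw [sub_eq_zero.1 hk0, one_smul] at hk
    exact sub_left_injective hk

theorem inner_tangent_normal (h : IsDeltahedral V r κ ℓ) {a b c : E3} (t : IsTriangle V κ a b c) :
    inner ℝ (b - a) ((2 : ℝ) • c - a - b) = 0 := by
  simp only [inner_sub_left, inner_sub_right, inner_smul_right, h.inner_self a t.fst_mem,
    h.inner_self b t.snd_mem, t.inner_fst_snd, t.inner_snd_trd, real_inner_comm c a,
    t.inner_trd_fst, real_inner_comm a b]
  ring

theorem norm_normal (h : IsDeltahedral V r κ ℓ) {a b c : E3} (t : IsTriangle V κ a b c) :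
    ‖(2 : ℝ) • c - a - b‖ ^ 2 = 6 * (r - κ) := by
  have e1 : inner ℝ a c = κ := by rw [real_inner_comm, t.inner_trd_fst]
  have e2 : inner ℝ b a = κ := by rw [real_inner_comm, t.inner_fst_snd]
  have e3 : inner ℝ c b = κ := by rw [real_inner_comm, t.inner_snd_trd]
  rw [← real_inner_self_eq_norm_sq]
  simp only [inner_sub_left, inner_sub_right, inner_smul_right, inner_smul_left,
    h.inner_self a t.fst_mem, h.inner_self b t.snd_mem, h.inner_self c t.trd_mem,
    t.inner_fst_snd, t.inner_snd_trd, t.inner_trd_fst, e1, e2, e3, conj_trivial]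
  ring

theorem normal_ne_zero (h : IsDeltahedral V r κ ℓ) {a b c : E3} (t : IsTriangle V κ a b c) :
    (2 : ℝ) • c - a - b ≠ 0 := by
  intro e
  have := h.norm_normal t
  rw [e, norm_zero] at this
  have := h.sub_pos
  linarith

theorem inHalfPlane_edge {a b c : E3} {x y : ℝ} (hxy : x + y = 1) (n' : E3) :
    InHalfPlane (convexHull ℝ {a, b, c}) (x • a + y • b) (b - a) ((2 : ℝ) • c - a - b) n' := by
  intro q hq
  obtain ⟨x', y', z', -, -, hz', hs, rfl⟩ := mem_convexHull_triangle.1 hq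
  refine ⟨y' - y + z' / 2, z' / 2, ?_, Or.inl (by linarith)⟩
  obtain rfl : x = 1 - y := by linarith
  obtain rfl : x' = 1 - y' - z' := by linarith
  module

/-- Unfolding one equilateral triangle beside another completes a rhombus: the new corner is `a + b
- c`, while `a` and `b` stay fixed. -/
theorem flipsInto_edge (h : IsDeltahedral V r κ ℓ) {a b c d : E3} (t : IsTriangle V κ a b c)
    (t' : IsTriangle V κ a b d) {x y : ℝ} (hxy : x + y = 1) :
    FlipsInto V (convexHull ℝ {a, b, c}) (convexHull ℝ {a, b, d}) (x • a + y • b) (b - a)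
      ((2 : ℝ) • c - a - b) ((2 : ℝ) • d - a - b) := by
  have sub := subset_convexHull ℝ ({a, b, c} : Set E3)
  have ma : a ∈ V ∩ convexHull ℝ {a, b, c} := ⟨t.fst_mem, sub (by simp)⟩
  have mb : b ∈ V ∩ convexHull ℝ {a, b, c} := ⟨t.snd_mem, sub (by simp)⟩
  have mc : c ∈ V ∩ convexHull ℝ {a, b, c} := ⟨t.trd_mem, sub (by simp)⟩
  obtain rfl : x = 1 - y := by linarith
  rintro v ⟨hv, hvd⟩
  rcases h.vertex_mem t' hv hvd with rfl | rfl | rfl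
  · exact ⟨v, ma, v, ma, v, ma, -y, 0, by module, by module⟩
  · exact ⟨v, mb, v, mb, v, mb, 1 - y, 0, by module, by module⟩
  · exact ⟨a, ma, b, mb, c, mc, 1 / 2 - y, 1 / 2, by module, by module⟩

theorem near_edge {a b c : E3} {x y δ : ℝ} (hxy : x + y = 1) (h0 : 0 < δ) (hx : δ < x)
    (hy : δ < y) :
    x • a + y • b + δ • (b - a) ∈ convexHull ℝ {a, b, c} ∧
      x • a + y • b + (δ / 2) • ((2 : ℝ) • c - a - b) ∈ convexHull ℝ {a, b, c} := by
  constructor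
  · exact mem_convexHull_triangle.2 ⟨x - δ, y + δ, 0, by linarith, by linarith, le_rfl,
      by linarith, by module⟩
  · exact mem_convexHull_triangle.2 ⟨x - δ / 2, y - δ / 2, δ, by linarith, by linarith, h0.le,
      by linarith, by module⟩

theorem isHinge_edge (h : IsDeltahedral V r κ ℓ) {a b c : E3} (t : IsTriangle V κ a b c) {x y : ℝ}
    (hx : 0 < x) (hy : 0 < y) (hxy : x + y = 1) :
    IsHinge (ofTriangles V ℓ) (x • a + y • b) (convexHull ℝ {a, b, c})
      (convexHull ℝ {a, b, (ℝ ∙ (a + b)).reflection c}) (b - a) ((2 : ℝ) • c - a - b)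
      ((2 : ℝ) • (ℝ ∙ (a + b)).reflection c - a - b) := by
  have td := h.reflect t
  have hne := h.ne_of_inner t.fst_mem t.inner_fst_snd
  have mem : ∀ e, x • a + y • b ∈ convexHull ℝ {a, b, e} := fun e =>
    mem_convexHull_triangle.2 ⟨x, y, 0, hx.le, hy.le, le_rfl, by linarith, by module⟩
  refine
    { left_mem := h.face_iff.2 ⟨a, b, c, t, rfl⟩
      right_mem := h.face_iff.2 ⟨a, b, _, td, rfl⟩
      mem_left := mem _
      mem_right := mem _
      eq_or_eq := ?_
      tangent_ne := sub_ne_zero.2 hne.symm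
      normal_ne := h.normal_ne_zero t
      inner_left := h.inner_tangent_normal t
      inner_right := h.inner_tangent_normal td
      norm_eq := (sq_eq_sq₀ (norm_nonneg _) (norm_nonneg _)).1
        ((h.norm_normal t).trans (h.norm_normal td).symm)
      ne := ?_
      left_subset := inHalfPlane_edge hxy _
      right_subset := inHalfPlane_edge hxy _
      -- The half leaves room for applying `near_edge` with `2 * δ`, since its step along the normal
      -- is half of its parameter.
      near := ⟨min x y / 2, by positivity, fun δ h0 h1 => ?_⟩
      flip_left := h.flipsInto_edge t td hxy
      flip_right := h.flipsInto_edge td t hxy }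
  · intro F hF hp
    obtain ⟨a', b', c', t', rfl⟩ := h.face_iff.1 hF
    have ha := h.mem_of_weight_pos (z := 0) t' t.fst_mem t.snd_mem t.snd_mem hx hy.le le_rfl
      (by linarith) (by rwa [zero_smul, add_zero])
    have hb := h.mem_of_weight_pos (z := 0) t' t.snd_mem t.fst_mem t.snd_mem hy hx.le le_rfl
      (by linarith) (by rwa [zero_smul, add_zero, add_comm])
    obtain ⟨e, te, heq⟩ := t'.exists_third hne ha hb
    rw [heq]
    rcases h.eq_or_eq_reflection t te with rfl | rfl
    · exact Or.inl rfl
    · exact Or.inr rfl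
  · intro e
    have e1 : (2 : ℝ) • c = (2 : ℝ) • (ℝ ∙ (a + b)).reflection c :=
      sub_left_injective (sub_left_injective e)
    exact h.reflection_ne t.fst_mem t.snd_mem t.inner_fst_snd t.trd_mem
      (smul_right_injective _ (two_ne_zero (α := ℝ)) e1).symm
  · have h2 := min_le_left x y
    have h3 := min_le_right x y
    refine ⟨⟨(near_edge hxy h0 ?_ ?_).1, (near_edge hxy h0 ?_ ?_).1⟩, ?_, ?_⟩
    iterate 4 linarith
    · have := (near_edge (a := a) (b := b) (c := c) (δ := 2 * δ) hxy (by linarith) (by linarith)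
        (by linarith)).2
      rwa [mul_div_cancel_left₀ _ (two_ne_zero (α := ℝ))] at this
    · have := (near_edge (a := a) (b := b) (c := (ℝ ∙ (a + b)).reflection c) (δ := 2 * δ) hxy
        (by linarith) (by linarith) (by linarith)).2
      rwa [mul_div_cancel_left₀ _ (two_ne_zero (α := ℝ))] at this

/-- The hinge is degenerate: the same face twice, with opposite normals. Unfolding does nothing, so
each corner `v` is its own image `v + v - v`. -/
theorem isHinge_interior (h : IsDeltahedral V r κ ℓ) {a b c : E3} (t : IsTriangle V κ a b c)
    {x y z : ℝ} (hx : 0 < x) (hy : 0 < y) (hz : 0 < z) (hs : x + y + z = 1) :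
    IsHinge (ofTriangles V ℓ) (x • a + y • b + z • c) (convexHull ℝ {a, b, c})
      (convexHull ℝ {a, b, c}) (b - a) ((2 : ℝ) • c - a - b) (-((2 : ℝ) • c - a - b)) := by
  have hne := h.ne_of_inner t.fst_mem t.inner_fst_snd
  have hF : convexHull ℝ {a, b, c} ∈ (ofTriangles V ℓ).faces := h.face_iff.2 ⟨a, b, c, t, rfl⟩
  have mem : x • a + y • b + z • c ∈ convexHull ℝ {a, b, c} :=
    mem_convexHull_triangle.2 ⟨x, y, z, hx.le, hy.le, hz.le, hs, rfl⟩
  have coord : ∀ q ∈ convexHull ℝ {a, b, c}, ∃ X Y : ℝ,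
      q = x • a + y • b + z • c + X • (b - a) + Y • ((2 : ℝ) • c - a - b) := by
    intro q hq
    obtain ⟨x', y', z', -, -, -, hs', rfl⟩ := mem_convexHull_triangle.1 hq
    refine ⟨y' - y + (z' - z) / 2, (z' - z) / 2, ?_⟩
    obtain rfl : x = 1 - y - z := by linarith
    obtain rfl : x' = 1 - y' - z' := by linarith
    module
  refine
    { left_mem := hF
      right_mem := hF
      mem_left := mem
      mem_right := mem
      eq_or_eq := ?_
      tangent_ne := sub_ne_zero.2 hne.symm
      normal_ne := h.normal_ne_zero t
      inner_left := h.inner_tangent_normal t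
      inner_right := by rw [inner_neg_right, h.inner_tangent_normal t, neg_zero]
      norm_eq := (norm_neg _).symm
      ne := fun e => h.normal_ne_zero t (by
        have e2 : (2 : ℝ) • ((2 : ℝ) • c - a - b) =
            ((2 : ℝ) • c - a - b) - -((2 : ℝ) • c - a - b) := by module
        rw [← e, sub_self] at e2
        exact (smul_eq_zero.1 e2).resolve_left two_ne_zero)
      left_subset := fun q hq => by
        obtain ⟨X, Y, e⟩ := coord q hq
        exact ⟨X, Y, e, Or.inr rfl⟩
      right_subset := fun q hq => by
        obtain ⟨X, Y, e⟩ := coord q hq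
        exact ⟨X, -Y, by rw [e, neg_smul_neg], Or.inr (neg_neg _).symm⟩
      near := ⟨min x (min y z) / 2, by positivity, fun δ h0 h1 => ?_⟩
      flip_left := fun v hv => by
        obtain ⟨X, Y, e⟩ := coord v hv.2
        exact ⟨v, hv, v, hv, v, hv, X, -Y, by rw [e, neg_smul_neg],
          by rw [add_sub_cancel_right, neg_smul, sub_neg_eq_add, e]⟩
      flip_right := fun v hv => by
        obtain ⟨X, Y, e⟩ := coord v hv.2
        exact ⟨v, hv, v, hv, v, hv, X, Y, e,
          by rw [add_sub_cancel_right, smul_neg, sub_neg_eq_add, e]⟩ }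
  · intro F hF hp
    obtain ⟨a', b', c', t', rfl⟩ := h.face_iff.1 hF
    have ha := h.mem_of_weight_pos t' t.fst_mem t.snd_mem t.trd_mem hx hy.le hz.le hs hp
    have hb := h.mem_of_weight_pos t' t.snd_mem t.trd_mem t.fst_mem hy hz.le hx.le
      (by linarith) (by convert hp using 1; abel)
    have hc := h.mem_of_weight_pos t' t.trd_mem t.fst_mem t.snd_mem hz hx.le hy.le
      (by linarith) (by convert hp using 1; abel)
    obtain ⟨e, te, heq⟩ := t'.exists_third hne ha hb
    rw [heq] at hc ⊢
    rcases hc with rfl | rfl | rfl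
    · exact absurd rfl (h.ne_of_inner t.trd_mem t.inner_trd_fst)
    · exact absurd rfl (h.ne_of_inner t.snd_mem t.inner_snd_trd)
    · exact Or.inl rfl
  · have h2 := min_le_left x (min y z)
    have h3 := (min_le_right x (min y z)).trans (min_le_left _ _)
    have h4 := (min_le_right x (min y z)).trans (min_le_right _ _)
    have m1 := mem_convexHull_triangle (a := a) (b := b) (c := c)
      (q := x • a + y • b + z • c + δ • (b - a)) |>.2
      ⟨x - δ, y + δ, z, by linarith, by linarith, by linarith, by linarith, by module⟩
    refine ⟨⟨m1, m1⟩, ?_, ?_⟩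
    · exact mem_convexHull_triangle.2 ⟨x - δ, y - δ, z + 2 * δ, by linarith, by linarith,
        by linarith, by linarith, by module⟩
    · exact mem_convexHull_triangle.2 ⟨x + δ, y + δ, z - 2 * δ, by linarith, by linarith,
        by linarith, by linarith, by module⟩

theorem isHalfTurn (h : IsDeltahedral V r κ ℓ) {a b : E3} (ha : a ∈ V) (hb : b ∈ V)
    (hab : inner ℝ a b = κ) : IsHalfTurn (ofTriangles V ℓ) (ℝ ∙ (a + b)).reflection where
  involutive := Submodule.reflection_reflection _
  map_face := by
    rintro F ⟨a', ha', b', hb', c', hc', h1, h2, h3, rfl⟩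
    refine ⟨_, h.reflection_mem a ha b hb hab a' ha', _, h.reflection_mem a ha b hb hab b' hb',
      _, h.reflection_mem a ha b hb hab c' hc', by rwa [LinearIsometryEquiv.dist_map],
      by rwa [LinearIsometryEquiv.dist_map], by rwa [LinearIsometryEquiv.dist_map], ?_⟩
    have := (ℝ ∙ (a + b)).reflection.toLinearEquiv.toLinearMap.image_convexHull {a', b', c'}
    simp only [image_insert_eq, image_singleton] at this
    exact this
  map_vertex := h.reflection_mem a ha b hb hab
  ne_self _ hv := h.reflection_ne ha hb hab hv

theorem exists_halfTurn_edge (h : IsDeltahedral V r κ ℓ) {a b c m : E3} (t : IsTriangle V κ a b c)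
    (hm : m = (1 / 2 : ℝ) • a + (1 / 2 : ℝ) • b) :
    ∃ (R : E3 ≃ₗᵢ[ℝ] E3) (F₁ F₂ : Set E3) (τ n₁ n₂ : E3), IsHalfTurn (ofTriangles V ℓ) R ∧
      IsHinge (ofTriangles V ℓ) m F₁ F₂ τ n₁ n₂ ∧ R m = m ∧ R τ = -τ ∧ R n₁ = n₂ := by
  have e1 := h.reflection_left t.fst_mem t.snd_mem t.inner_fst_snd
  have e2 := h.reflection_right t.fst_mem t.snd_mem t.inner_fst_snd
  refine ⟨_, _, _, _, _, _, h.isHalfTurn t.fst_mem t.snd_mem t.inner_fst_snd,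
    hm ▸ h.isHinge_edge t (by norm_num) (by norm_num) (by norm_num), ?_, ?_, ?_⟩
  · rw [hm, map_add, map_smul, map_smul, e1, e2, add_comm]
  · rw [map_sub, e1, e2, neg_sub]
  · rw [map_sub, map_sub, map_smul, e1, e2, sub_right_comm]

theorem inner_sub_sub (h : IsDeltahedral V r κ ℓ) {a b c : E3} (t : IsTriangle V κ a b c) :
    inner ℝ (b - a) (b - a) = ℓ ^ 2 ∧ inner ℝ (c - a) (c - a) = ℓ ^ 2 ∧
      inner ℝ (b - a) (c - a) = 1 / 2 * ℓ ^ 2 := by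
  have e1 : inner ℝ a c = κ := by rw [real_inner_comm, t.inner_trd_fst]
  have e2 : inner ℝ b a = κ := by rw [real_inner_comm, t.inner_fst_snd]
  refine ⟨?_, ?_, ?_⟩
  all_goals
    simp only [inner_sub_left, inner_sub_right, h.inner_self a t.fst_mem,
      h.inner_self b t.snd_mem, h.inner_self c t.trd_mem, t.inner_fst_snd, t.inner_snd_trd,
      t.inner_trd_fst, e1, e2, h.sq_eq]
    ring

/-- The geometry of a triangulated solid is reduced to barycentric coordinates: zero weights
separate corners, edges and interior, and half-integral weights single out the possible midpoints.
-/
theorem isRollable (h : IsDeltahedral V r κ ℓ) : IsRollable (ofTriangles V ℓ) ℓ where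
  pos := h.pos
  finite := by
    refine ((h.finite.prod (h.finite.prod h.finite)).image
      fun t : E3 × E3 × E3 => convexHull ℝ {t.1, t.2.1, t.2.2}).subset ?_
    rintro F ⟨a, ha, b, hb, c, hc, -, -, -, rfl⟩
    exact ⟨(a, b, c), ⟨ha, hb, hc⟩, rfl⟩
  closed := by
    rintro F ⟨a, ha, b, hb, c, hc, -, -, -, rfl⟩
    exact (toFinite {a, b, c}).isClosed_convexHull ℝ
  exists_hinge := by
    rintro p ⟨F, hF, hp⟩ hpV
    obtain ⟨a, b, c, t, rfl⟩ := h.face_iff.1 hF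
    obtain ⟨x, y, z, hx, hy, hz, hs, rfl⟩ := mem_convexHull_triangle.1 hp
    have edge : ∀ {a b c : E3} {x y : ℝ}, IsTriangle V κ a b c → 0 ≤ x → 0 ≤ y → x + y = 1 →
        x • a + y • b ∉ V → ∃ F₁ F₂ τ n₁ n₂, IsHinge (ofTriangles V ℓ) (x • a + y • b)
          F₁ F₂ τ n₁ n₂ := by
      intro a b c x y t hx hy hs hV
      rcases hx.eq_or_lt with rfl | hx
      · obtain rfl : y = 1 := by linarith
        rw [zero_smul, one_smul, zero_add] at hV
        exact absurd t.snd_mem hV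
      rcases hy.eq_or_lt with rfl | hy
      · obtain rfl : x = 1 := by linarith
        rw [zero_smul, one_smul, add_zero] at hV
        exact absurd t.fst_mem hV
      exact ⟨_, _, _, _, _, h.isHinge_edge t hx hy hs⟩
    rcases hx.eq_or_lt with rfl | hx
    · rw [zero_smul, zero_add] at hpV ⊢
      exact edge t.rotate hy hz (by linarith) hpV
    rcases hy.eq_or_lt with rfl | hy
    · rw [zero_smul, add_zero, add_comm] at hpV ⊢
      exact edge t.rotate.rotate hz hx.le (by linarith) hpV
    rcases hz.eq_or_lt with rfl | hz
    · rw [zero_smul, add_zero] at hpV ⊢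
      exact edge t hx.le hy.le (by linarith) hpV
    exact ⟨_, _, _, _, _, h.isHinge_interior t hx hy hz hs⟩
  exists_lattice := by
    intro F hF
    obtain ⟨a, b, c, t, rfl⟩ := h.face_iff.1 hF
    obtain ⟨i1, i2, i3⟩ := h.inner_sub_sub t
    refine ⟨translationToOrigin a, AddSubgroup.closure {b - a, c - a},
      minNorm_closure_pair (Or.inr rfl) i1 i2 i3, ?_⟩
    rintro v ⟨hv, hvF⟩
    rw [translationToOrigin_apply]
    rcases h.vertex_mem t hv hvF with rfl | rfl | rfl
    · rw [sub_self]
      exact zero_mem _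
    · exact AddSubgroup.subset_closure (by simp)
    · exact AddSubgroup.subset_closure (by simp)
  exists_halfTurn := by
    intro F hF g Λ hΛ hg m hm hmV hgm
    obtain ⟨a, b, c, t, rfl⟩ := h.face_iff.1 hF
    obtain ⟨x, y, z, hx, hy, hz, hs, rfl⟩ := mem_convexHull_triangle.1 hm
    have sub := subset_convexHull ℝ ({a, b, c} : Set E3)
    obtain ⟨i1, i2, i3⟩ := h.inner_sub_sub t
    have hx' : x = 1 - y - z := by linarith
    have e : x • a + y • b + z • c = a + y • (b - a) + z • (c - a) := by
      rw [hx']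
      module
    rw [e] at hgm
    obtain ⟨⟨i, hi⟩, j, hj⟩ := hΛ.exists_half_int h.pos (Or.inr rfl)
      (hg a ⟨t.fst_mem, sub (by simp)⟩) (hg b ⟨t.snd_mem, sub (by simp)⟩)
      (hg c ⟨t.trd_mem, sub (by simp)⟩) i1 i2 i3 hgm
    have i0 : 0 ≤ i := by
      have : (0 : ℝ) ≤ i := by linarith
      exact_mod_cast this
    have j0 : 0 ≤ j := by
      have : (0 : ℝ) ≤ j := by linarith
      exact_mod_cast this
    have ij : i + j ≤ 2 := by
      have : (i : ℝ) + j ≤ 2 := by linarith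
      exact_mod_cast this
    have hy' : y = (i : ℝ) / 2 := by linarith
    have hz' : z = (j : ℝ) / 2 := by linarith
    rw [hx', hy', hz'] at hmV ⊢
    have corner : ∀ v ∈ V, ∀ w, w = v → w ∈ V := fun v hv w e => e ▸ hv
    have i2 : i ≤ 2 := by lia
    have j2 : j ≤ 2 := by lia
    -- Twice the weights of `b` and `c` are nonnegative integers with sum at most `2`. The six
    -- solutions are the three corners, excluded by `hmV`, and the three edge midpoints.
    interval_cases i <;> interval_cases j <;> first | lia | skip
    · exact absurd (corner _ t.fst_mem _ (by push_cast; module)) hmV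
    · exact h.exists_halfTurn_edge t.rotate.rotate (by push_cast; module)
    · exact absurd (corner _ t.trd_mem _ (by push_cast; module)) hmV
    · exact h.exists_halfTurn_edge t (by push_cast; module)
    · exact h.exists_halfTurn_edge t.rotate (by push_cast; module)
    · exact absurd (corner _ t.snd_mem _ (by push_cast; module)) hmV

end IsDeltahedral

/-! ### The cube -/

/-- The standard basis vectors of space. -/
noncomputable def basisVec (i : Fin 3) : E3 := EuclideanSpace.single i 1

@[simp] theorem basisVec_self (i : Fin 3) : basisVec i i = 1 := by simp [basisVec]

theorem basisVec_ne {i j : Fin 3} (h : j ≠ i) : basisVec i j = 0 := by simp [basisVec, h]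

/-- The three coordinate axes, in some order. -/
structure IsAxes (i j k : Fin 3) : Prop where
  ij : i ≠ j
  jk : j ≠ k
  ik : i ≠ k

namespace IsAxes

variable {i j k : Fin 3}

theorem swap_left (h : IsAxes i j k) : IsAxes j i k := ⟨h.ij.symm, h.ik, h.jk⟩

theorem swap_right (h : IsAxes i j k) : IsAxes i k j := ⟨h.ik, h.jk.symm, h.ij⟩

theorem exists_of (i : Fin 3) : ∃ j k, IsAxes i j k := by
  refine ⟨i + 1, i + 2, ?_, ?_, ?_⟩ <;> revert i <;> decide

theorem eq_or (h : IsAxes i j k) (l : Fin 3) : l = i ∨ l = j ∨ l = k := by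
  obtain ⟨h1, h2, h3⟩ := h
  revert i j k l
  decide

theorem forall_iff (h : IsAxes i j k) {p : Fin 3 → Prop} : (∀ l, p l) ↔ p i ∧ p j ∧ p k :=
  ⟨fun H => ⟨H i, H j, H k⟩, fun H l => by
    rcases h.eq_or l with rfl | rfl | rfl
    exacts [H.1, H.2.1, H.2.2]⟩

theorem ext_iff (h : IsAxes i j k) {x y : E3} : x = y ↔ x i = y i ∧ x j = y j ∧ x k = y k := by
  rw [← h.forall_iff (p := fun l => x l = y l)]
  exact ⟨fun e l => e ▸ rfl, fun e => by ext l; exact e l⟩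

theorem inner_eq (h : IsAxes i j k) (x y : E3) :
    inner ℝ x y = x i * y i + x j * y j + x k * y k := by
  rw [E3.inner_eq]
  have hs : ∀ f : Fin 3 → ℝ, f 0 + f 1 + f 2 = f i + f j + f k := by
    intro f
    obtain ⟨h1, h2, h3⟩ := h
    fin_cases i <;> fin_cases j <;> fin_cases k <;> first | exact absurd rfl ‹_› | skip
    all_goals
      simp
      try ring
  exact hs fun l => x l * y l

theorem coords (h : IsAxes i j k) : basisVec i j = 0 ∧ basisVec i k = 0 ∧ basisVec j i = 0 ∧
    basisVec j k = 0 ∧ basisVec k i = 0 ∧ basisVec k j = 0 :=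
  ⟨basisVec_ne h.ij.symm, basisVec_ne h.ik.symm, basisVec_ne h.ij, basisVec_ne h.jk.symm,
    basisVec_ne h.ik, basisVec_ne h.jk⟩

end IsAxes

/-- The face of the cube on which the coordinate `i` is equal to `s`. -/
def cubeFace (i : Fin 3) (s : ℝ) : Set E3 := {x | x i = s ∧ ∀ j, |x j| ≤ 1}

theorem cubeFace_mem {i : Fin 3} {s : ℝ} (hs : s = 1 ∨ s = -1) : cubeFace i s ∈ cube.faces :=
  ⟨i, s, hs, rfl⟩

theorem mul_self_of_sign {s : ℝ} (hs : s = 1 ∨ s = -1) : s * s = 1 := by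
  rcases hs with rfl | rfl <;> norm_num

theorem abs_le_one_of_sign {s : ℝ} (hs : s = 1 ∨ s = -1) : |s| ≤ 1 := by
  rcases hs with rfl | rfl <;> norm_num

theorem sign_mul {s t : ℝ} (hs : s = 1 ∨ s = -1) (ht : t = 1 ∨ t = -1) :
    s * t = 1 ∨ s * t = -1 := by
  rcases hs with rfl | rfl <;> rcases ht with rfl | rfl <;> norm_num

theorem mul_le_one_of_sign {s x : ℝ} (hs : s = 1 ∨ s = -1) (hx : |x| ≤ 1) : s * x ≤ 1 := by
  have := abs_le.1 hx
  rcases hs with rfl | rfl <;> linarith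

theorem not_sign_of_abs_lt {x : ℝ} (hx : |x| < 1) : ¬ (x = 1 ∨ x = -1) := by
  rintro (rfl | rfl) <;> norm_num at hx

theorem abs_add_le_one {x δ : ℝ} (h0 : 0 < δ) (h : δ < 1 - |x|) :
    |x + δ| ≤ 1 ∧ |x - δ| ≤ 1 := by
  have := neg_abs_le x
  have := le_abs_self x
  constructor <;> rw [abs_le] <;> constructor <;> linarith

/-- From the edge, the face `x i = s` extends in direction `-s' • basisVec j` and the other face in
direction `-s • basisVec i`, each towards the interior of the corresponding coordinate range. -/
theorem isHinge_cube_edge {i j k : Fin 3} (h : IsAxes i j k) {s s' : ℝ} (hs : s = 1 ∨ s = -1)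
    (hs' : s' = 1 ∨ s' = -1) {p : E3} (hi : p i = s) (hj : p j = s') (hk : |p k| < 1) :
    IsHinge cube p (cubeFace i s) (cubeFace j s') (basisVec k) (-s' • basisVec j)
      (-s • basisVec i) := by
  have hss := mul_self_of_sign hs
  have hss' := mul_self_of_sign hs'
  have half : ∀ {i j k : Fin 3} (h : IsAxes i j k) {s s' : ℝ} (hs' : s' = 1 ∨ s' = -1)
      (hi : p i = s) (hj : p j = s') (n : E3),
      InHalfPlane (cubeFace i s) p (basisVec k) (-s' • basisVec j) n := by
    intro i j k h s s' hs' hi hj n q hq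
    obtain ⟨c1, c2, c3, c4, c5, c6⟩ := h.coords
    refine ⟨q k - p k, 1 - s' * q j, ?_, Or.inl (by linarith [mul_le_one_of_sign hs' (hq.2 j)])⟩
    rw [h.ext_iff]
    simp [c3, c4, c5, c6, hi, hj, hq.1]
    linear_combination -q j * mul_self_of_sign hs'
  have flip : ∀ {i j k : Fin 3} (h : IsAxes i j k) {s s' : ℝ} (hs : s = 1 ∨ s = -1)
      (hs' : s' = 1 ∨ s' = -1) (hi : p i = s) (hj : p j = s'),
      FlipsInto cube.vertices (cubeFace i s) (cubeFace j s') p (basisVec k) (-s' • basisVec j)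
        (-s • basisVec i) := by
    rintro i j k h s s' hs hs' hi hj v ⟨hv, hvj, -⟩
    obtain ⟨c1, c2, c3, c4, c5, c6⟩ := h.coords
    have mem : ∀ t : ℝ, t = 1 ∨ t = -1 →
        s • basisVec i + t • basisVec j + v k • basisVec k ∈ cube.vertices ∩ cubeFace i s := by
      intro t ht
      have ei : (s • basisVec i + t • basisVec j + v k • basisVec k) i = s := by simp [c3, c5]
      have ej : (s • basisVec i + t • basisVec j + v k • basisVec k) j = t := by simp [c1, c6]
      have ek : (s • basisVec i + t • basisVec j + v k • basisVec k) k = v k := by simp [c2, c4]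
      refine ⟨h.forall_iff.2 ?_, ei, h.forall_iff.2 ?_⟩
      · rw [ei, ej, ek]
        exact ⟨hs, ht, hv k⟩
      · rw [ei, ej, ek]
        exact ⟨abs_le_one_of_sign hs, abs_le_one_of_sign ht, abs_le_one_of_sign (hv k)⟩
    -- The corner `v` is at distance `1 - s * v i` from the edge, so unfolded it has coordinate `s'
    -- + s' * (1 - s * v i)` along `j`. This is `2 * s'` minus the coordinate `s' * s * v i` of the
    -- third chosen corner.
    refine ⟨_, mem s' hs', _, mem s' hs', _, mem (s' * s * v i) (sign_mul (sign_mul hs' hs) (hv i)),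
      v k - p k, 1 - s * v i, ?_, ?_⟩
    · rw [h.ext_iff]
      simp [c1, c2, c5, c6, hi, hj, hvj]
      linear_combination -v i * mul_self_of_sign hs
    · rw [h.ext_iff]
      simp [c1, c2, c3, c4, c5, c6, hi, hj]
      ring
  obtain ⟨c1, c2, c3, c4, c5, c6⟩ := h.coords
  have bound : ∀ l, |p l| ≤ 1 := h.forall_iff.2
    ⟨hi ▸ abs_le_one_of_sign hs, hj ▸ abs_le_one_of_sign hs', hk.le⟩
  have shift : ∀ {i j k : Fin 3} (h : IsAxes i j k) {s s' : ℝ} (hs : s = 1 ∨ s = -1)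
      (hs' : s' = 1 ∨ s' = -1) (hi : p i = s) (hj : p j = s') (hk : |p k| < 1) {δ : ℝ}
      (h0 : 0 < δ) (h1 : δ < 1 - |p k|),
      p + δ • basisVec k ∈ cubeFace i s ∧ p + δ • (-s' • basisVec j) ∈ cubeFace i s := by
    intro i j k h s s' hs hs' hi hj hk δ h0 h1
    obtain ⟨c1, c2, c3, c4, c5, c6⟩ := h.coords
    have := abs_nonneg (p k)
    refine ⟨⟨by simp [c5, hi], h.forall_iff.2 ?_⟩, ⟨by simp [c3, hi], h.forall_iff.2 ?_⟩⟩
    · simp [c5, c6, hi, hj, abs_le_one_of_sign hs, abs_le_one_of_sign hs',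
        (abs_add_le_one h0 h1).1]
    · simp only [PiLp.add_apply, PiLp.smul_apply, c3, c4, basisVec_self, hi, hj, smul_eq_mul,
        mul_zero, add_zero, mul_one]
      refine ⟨abs_le_one_of_sign hs, ?_, hk.le⟩
      rw [abs_le]
      rcases hs' with rfl | rfl <;> constructor <;> linarith
  have s0 : s ≠ 0 := left_ne_zero_of_mul_eq_one hss
  have s0' : s' ≠ 0 := left_ne_zero_of_mul_eq_one hss'
  refine
    { left_mem := cubeFace_mem hs
      right_mem := cubeFace_mem hs'
      mem_left := ⟨hi, bound⟩
      mem_right := ⟨hj, bound⟩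
      eq_or_eq := ?_
      tangent_ne := fun e => by simpa using congrArg (fun v : E3 => v k) e
      normal_ne := fun e => by simpa [s0'] using congrArg (fun v : E3 => v j) e
      inner_left := by
        rw [h.inner_eq]
        simp [c3, c4, c6]
      inner_right := by
        rw [h.inner_eq]
        simp [c1, c2, c5]
      norm_eq := by
        rw [norm_smul, norm_smul]
        rcases hs with rfl | rfl <;> rcases hs' with rfl | rfl <;> simp [basisVec]
      ne := fun e => by simpa [c1, s0'] using congrArg (fun v : E3 => v j) e
      left_subset := half h hs' hi hj _
      right_subset := half h.swap_left hs hj hi _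
      near := ⟨1 - |p k|, by linarith, fun δ h0 h1 => ?_⟩
      flip_left := flip h hs hs' hi hj
      flip_right := flip h.swap_left hs' hs hj hi }
  · rintro F ⟨l, t, ht, rfl⟩ ⟨hl, -⟩
    rcases h.eq_or l with rfl | rfl | rfl
    · exact Or.inl (by rw [← hi, hl]; rfl)
    · exact Or.inr (by rw [← hj, hl]; rfl)
    · exact absurd (hl ▸ ht) (not_sign_of_abs_lt hk)
  · have a1 := shift h hs hs' hi hj hk h0 h1
    have a2 := shift h.swap_left hs' hs hj hi hk h0 h1
    exact ⟨⟨a1.1, a2.1⟩, a1.2, a2.2⟩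

theorem isHinge_cube_interior {i j k : Fin 3} (h : IsAxes i j k) {s : ℝ} (hs : s = 1 ∨ s = -1)
    {p : E3} (hi : p i = s) (hj : |p j| < 1) (hk : |p k| < 1) :
    IsHinge cube p (cubeFace i s) (cubeFace i s) (basisVec j) (basisVec k) (-basisVec k) := by
  obtain ⟨c1, c2, c3, c4, c5, c6⟩ := h.coords
  have bound : ∀ l, |p l| ≤ 1 := h.forall_iff.2
    ⟨hi ▸ abs_le_one_of_sign hs, hj.le, hk.le⟩
  have coord : ∀ q ∈ cubeFace i s, q = p + (q j - p j) • basisVec j + (q k - p k) • basisVec k := by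
    intro q hq
    rw [h.ext_iff]
    simp [c3, c4, c5, c6, hi, hq.1]
  have hkn : basisVec k ≠ 0 := fun e => by simpa using congrArg (fun v : E3 => v k) e
  refine
    { left_mem := cubeFace_mem hs
      right_mem := cubeFace_mem hs
      mem_left := ⟨hi, bound⟩
      mem_right := ⟨hi, bound⟩
      eq_or_eq := ?_
      tangent_ne := fun e => by simpa using congrArg (fun v : E3 => v j) e
      normal_ne := hkn
      inner_left := by
        rw [h.inner_eq]
        simp [c3, c4, c6]
      inner_right := by
        rw [h.inner_eq]
        simp [c3, c4, c6]
      norm_eq := (norm_neg _).symm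
      ne := fun e => by
        have := congrArg (fun v : E3 => v k) e
        norm_num at this
      left_subset := fun q hq => ⟨_, _, coord q hq, Or.inr rfl⟩
      right_subset := fun q hq => ⟨q j - p j, -(q k - p k), by
        rw [neg_smul_neg]
        exact coord q hq, Or.inr (neg_neg _).symm⟩
      near := ⟨min (1 - |p j|) (1 - |p k|), lt_min (by linarith) (by linarith),
        fun δ h0 h1 => ?_⟩
      flip_left := fun v hv => ⟨v, hv, v, hv, v, hv, v j - p j, -(v k - p k), by
        rw [neg_smul_neg]
        exact coord v hv.2, by
        rw [add_sub_cancel_right, neg_smul, sub_neg_eq_add]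
        exact coord v hv.2⟩
      flip_right := fun v hv => ⟨v, hv, v, hv, v, hv, v j - p j, v k - p k, coord v hv.2, by
        rw [add_sub_cancel_right, smul_neg, sub_neg_eq_add]
        exact coord v hv.2⟩ }
  · rintro F ⟨l, t, ht, rfl⟩ ⟨hl, -⟩
    rcases h.eq_or l with rfl | rfl | rfl
    · exact Or.inl (by rw [← hi, hl]; rfl)
    · exact absurd (hl ▸ ht) (not_sign_of_abs_lt hj)
    · exact absurd (hl ▸ ht) (not_sign_of_abs_lt hk)
  · have a1 := abs_add_le_one h0 (h1.trans_le (min_le_left _ _))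
    have a2 := abs_add_le_one h0 (h1.trans_le (min_le_right _ _))
    have b := abs_le_one_of_sign hs
    have m1 : p + δ • basisVec j ∈ cubeFace i s :=
      ⟨by simp [c3, hi], h.forall_iff.2 (by simp [c3, c4, hi, b, a1.1, hk.le])⟩
    refine ⟨⟨m1, m1⟩, ⟨by simp [c5, hi], h.forall_iff.2 ?_⟩, by simp [c5, hi], h.forall_iff.2 ?_⟩
    · simp [c5, c6, hi, b, a2.1, hj.le]
    · simp [c5, c6, hi, b, ← sub_eq_add_neg, a2.2, hj.le]

/-- Symmetries of the cube, as signed permutations of the coordinates. -/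
theorem isHalfTurn_cube {R : E3 ≃ₗᵢ[ℝ] E3} (hR : ∀ x, R (R x) = x) (π : Equiv.Perm (Fin 3))
    (σ : Fin 3 → ℝ) (hσ : ∀ l, σ l = 1 ∨ σ l = -1) (h : ∀ x l, R x l = σ l * x (π l)) {k : Fin 3}
    (hk : π k = k) (hσk : σ k = -1) : IsHalfTurn cube R where
  involutive := hR
  map_face := by
    rintro F ⟨i, s, hs, rfl⟩
    refine ⟨π i, σ i * s, sign_mul (hσ i) hs, ?_⟩
    have e : R '' {x | x i = s ∧ ∀ j, |x j| ≤ 1} = R ⁻¹' {x | x i = s ∧ ∀ j, |x j| ≤ 1} :=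
      congrFun (image_eq_preimage_of_inverse hR hR) _
    rw [e]
    ext y
    simp only [mem_preimage, mem_ofPred_eq, h, abs_mul]
    have hσ1 : ∀ l, |σ l| = 1 := fun l => by rcases hσ l with e | e <;> simp [e]
    simp only [hσ1, one_mul]
    refine and_congr ⟨fun e => ?_, fun e => ?_⟩ (π.forall_congr_right (q := fun l => |y l| ≤ 1))
    · rw [← e, ← mul_assoc, mul_self_of_sign (hσ i), one_mul]
    · rw [e, ← mul_assoc, mul_self_of_sign (hσ i), one_mul]
  map_vertex v hv l := by
    rw [h]
    exact sign_mul (hσ l) (hv (π l))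
  ne_self v hv e := by
    have e1 := congrArg (fun x : E3 => x k) e
    simp only [h, hk, hσk] at e1
    have := hv k
    rcases this with e2 | e2 <;> rw [e2] at e1 <;> norm_num at e1

theorem reflection_line_apply (m x : E3) (l : Fin 3) : (ℝ ∙ m).reflection x l =
    2 * (inner ℝ m x / inner ℝ m m) * m l - x l := by
  rw [Submodule.reflection_singleton_apply, RCLike.ofReal_real_eq_id, id,
    real_inner_self_eq_norm_sq, ← Nat.cast_smul_eq_nsmul ℝ 2, smul_smul]
  simp

/-- The half-turn about the axis through a face centre keeps the coordinate `i` and negates the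
other two. -/
theorem exists_halfTurn_cube_center {i j k : Fin 3} (h : IsAxes i j k) {s : ℝ}
    (hs : s = 1 ∨ s = -1) {m : E3} (hi : m i = s) (hj : m j = 0) (hk : m k = 0) :
    ∃ (R : E3 ≃ₗᵢ[ℝ] E3) (F₁ F₂ : Set E3) (τ n₁ n₂ : E3), IsHalfTurn cube R ∧
      IsHinge cube m F₁ F₂ τ n₁ n₂ ∧ R m = m ∧ R τ = -τ ∧ R n₁ = n₂ := by
  obtain ⟨c1, c2, c3, c4, c5, c6⟩ := h.coords
  have hss := mul_self_of_sign hs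
  have H : ∀ (x : E3) (l : Fin 3), (ℝ ∙ m).reflection x l =
      (if l = i then 1 else -1) * x l := by
    intro x
    rw [h.forall_iff]
    simp only [reflection_line_apply, h.inner_eq, hi, hj, hk, hss, h.ij.symm, h.ik.symm,
      if_true, if_false]
    refine ⟨?_, by ring, by ring⟩
    linear_combination 2 * x i * hss
  refine ⟨_, _, _, _, _, _, isHalfTurn_cube (Submodule.reflection_reflection _) 1 _ (fun l => ?_)
    H (k := k) rfl (if_neg h.ik.symm), isHinge_cube_interior h hs hi (by simp [hj])
    (by simp [hk]), ?_, ?_, ?_⟩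
  · split_ifs <;> simp
  · exact Submodule.reflection_mem_subspace_eq_self (Submodule.mem_span_singleton_self m)
  · rw [h.ext_iff]
    simp [H, c3, c4, h.ij.symm]
  · rw [h.ext_iff]
    simp [H, c5, c6, h.ik.symm]

/-- The half-turn about the axis through an edge midpoint exchanges the coordinates `i` and `j`, up
to the common sign `s * s'`, and negates `k`; so it exchanges the two faces at the edge. -/
theorem exists_halfTurn_cube_edge {i j k : Fin 3} (h : IsAxes i j k) {s s' : ℝ}
    (hs : s = 1 ∨ s = -1) (hs' : s' = 1 ∨ s' = -1) {m : E3} (hi : m i = s) (hj : m j = s')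
    (hk : m k = 0) :
    ∃ (R : E3 ≃ₗᵢ[ℝ] E3) (F₁ F₂ : Set E3) (τ n₁ n₂ : E3), IsHalfTurn cube R ∧
      IsHinge cube m F₁ F₂ τ n₁ n₂ ∧ R m = m ∧ R τ = -τ ∧ R n₁ = n₂ := by
  obtain ⟨c1, c2, c3, c4, c5, c6⟩ := h.coords
  have hss := mul_self_of_sign hs
  have hss' := mul_self_of_sign hs'
  have H : ∀ (x : E3) (l : Fin 3), (ℝ ∙ m).reflection x l =
      (if l = k then -1 else s * s') * x (Equiv.swap i j l) := by
    intro x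
    rw [h.forall_iff]
    simp only [reflection_line_apply, h.inner_eq, hi, hj, hk, hss, hss', h.ik, h.jk,
      if_true, if_false, Equiv.swap_apply_left, Equiv.swap_apply_right,
      Equiv.swap_apply_of_ne_of_ne h.ik.symm h.jk.symm]
    refine ⟨?_, ?_, by ring⟩
    · linear_combination x i * hss
    · linear_combination x j * hss'
  refine ⟨_, _, _, _, _, _, isHalfTurn_cube (Submodule.reflection_reflection _) (Equiv.swap i j) _
    (fun l => ?_) H (k := k) (Equiv.swap_apply_of_ne_of_ne h.ik.symm h.jk.symm) (if_pos rfl),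
    isHinge_cube_edge h hs hs' hi hj (by simp [hk]), ?_, ?_, ?_⟩
  · split_ifs
    · exact Or.inr rfl
    · exact sign_mul hs hs'
  · exact Submodule.reflection_mem_subspace_eq_self (Submodule.mem_span_singleton_self m)
  · rw [h.ext_iff]
    simp [H, c5, c6, h.ik, h.jk, Equiv.swap_apply_of_ne_of_ne h.ik.symm h.jk.symm]
  · rw [h.ext_iff]
    simp [H, c1, c2, c3, c4, h.ik, h.jk, Equiv.swap_apply_of_ne_of_ne h.ik.symm h.jk.symm]
    linear_combination s * hss'

theorem cube_isRollable : IsRollable cube 2 where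
  pos := two_pos
  finite := by
    refine (((finite_univ (α := Fin 3)).prod (toFinite ({1, -1} : Set ℝ))).image
      fun t : Fin 3 × ℝ => cubeFace t.1 t.2).subset ?_
    rintro F ⟨i, s, hs, rfl⟩
    exact ⟨(i, s), ⟨mem_univ _, hs⟩, rfl⟩
  closed := by
    rintro F ⟨i, s, hs, rfl⟩
    have h1 : IsClosed {x : E3 | x i = s} := isClosed_eq (by fun_prop) continuous_const
    have h2 : IsClosed {x : E3 | ∀ j, |x j| ≤ 1} := by
      rw [ofPred_forall]
      exact isClosed_iInter fun j => isClosed_le (by fun_prop) continuous_const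
    exact h1.inter h2
  exists_hinge := by
    rintro p ⟨F, ⟨i, s, hs, rfl⟩, hi, hb⟩ hpV
    obtain ⟨j, k, h⟩ := IsAxes.exists_of i
    have sign : ∀ l, ¬ |p l| < 1 → p l = 1 ∨ p l = -1 := fun l hl =>
      eq_or_eq_neg_of_abs_eq (le_antisymm (hb l) (not_lt.1 hl))
    by_cases hj : |p j| < 1
    · by_cases hk : |p k| < 1
      · exact ⟨_, _, _, _, _, isHinge_cube_interior h hs hi hj hk⟩
      · exact ⟨_, _, _, _, _, isHinge_cube_edge h.swap_right hs (sign k hk) hi rfl hj⟩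
    · by_cases hk : |p k| < 1
      · exact ⟨_, _, _, _, _, isHinge_cube_edge h hs (sign j hj) hi rfl hk⟩
      · exact absurd (h.forall_iff.2 ⟨hi.symm ▸ hs, sign j hj, sign k hk⟩) hpV
  exists_lattice := by
    rintro F ⟨i, s, hs, rfl⟩
    obtain ⟨j, k, h⟩ := IsAxes.exists_of i
    obtain ⟨c1, c2, c3, c4, c5, c6⟩ := h.coords
    -- The corner `a` becomes the origin, and the face a fundamental square of the lattice spanned
    -- by its two sides.
    set a : E3 := s • basisVec i - basisVec j - basisVec k with ha
    refine ⟨translationToOrigin a,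
      AddSubgroup.closure {(2 : ℝ) • basisVec j, (2 : ℝ) • basisVec k},
      minNorm_closure_pair (c := 0) (Or.inl rfl) ?_ ?_ ?_, ?_⟩
    · rw [h.inner_eq]
      norm_num [c3, c4]
    · rw [h.inner_eq]
      norm_num [c5, c6]
    · rw [h.inner_eq]
      simp [c3, c4, c5, c6]
    rintro v ⟨hv, hvi, -⟩
    rw [translationToOrigin_apply]
    have int : ∀ l, ∃ n : ℤ, v l + 1 = n * 2 := fun l => by
      rcases hv l with e | e
      · exact ⟨1, by rw [e]; norm_num⟩
      · exact ⟨0, by rw [e]; norm_num⟩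
    obtain ⟨n, hn⟩ := int j
    obtain ⟨n', hn'⟩ := int k
    rw [AddSubgroup.mem_closure_pair]
    refine ⟨n, n', ?_⟩
    rw [← Int.cast_smul_eq_zsmul ℝ, ← Int.cast_smul_eq_zsmul ℝ, smul_smul, smul_smul, ← hn, ← hn',
      ha, h.ext_iff]
    simp [c1, c2, c3, c4, c5, c6, hvi]
  exists_halfTurn := by
    rintro F ⟨i, s, hs, rfl⟩ g Λ hΛ hg m ⟨hi, hb⟩ hmV hgm
    obtain ⟨j, k, h⟩ := IsAxes.exists_of i
    obtain ⟨c1, c2, c3, c4, c5, c6⟩ := h.coords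
    have mem : ∀ t t' : ℝ, (t = 1 ∨ t = -1) → (t' = 1 ∨ t' = -1) →
        g (s • basisVec i + t • basisVec j + t' • basisVec k) ∈ Λ := by
      intro t t' ht ht'
      refine hg _ ?_
      have ei : (s • basisVec i + t • basisVec j + t' • basisVec k) i = s := by simp [c3, c5]
      have ej : (s • basisVec i + t • basisVec j + t' • basisVec k) j = t := by simp [c1, c6]
      have ek : (s • basisVec i + t • basisVec j + t' • basisVec k) k = t' := by simp [c2, c4]
      refine ⟨h.forall_iff.2 ?_, ei, h.forall_iff.2 ?_⟩
      · rw [ei, ej, ek]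
        exact ⟨hs, ht, ht'⟩
      · rw [ei, ej, ek]
        exact ⟨abs_le_one_of_sign hs, abs_le_one_of_sign ht, abs_le_one_of_sign ht'⟩
    have p1 : (1 : ℝ) = 1 ∨ (1 : ℝ) = -1 := Or.inl rfl
    have p2 : (-1 : ℝ) = 1 ∨ (-1 : ℝ) = -1 := Or.inr rfl
    set a : E3 := s • basisVec i + (-1 : ℝ) • basisVec j + (-1 : ℝ) • basisVec k with ha
    set b : E3 := s • basisVec i + (1 : ℝ) • basisVec j + (-1 : ℝ) • basisVec k with hb'
    set c : E3 := s • basisVec i + (-1 : ℝ) • basisVec j + (1 : ℝ) • basisVec k with hc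
    have eb : b - a = (2 : ℝ) • basisVec j := by
      rw [ha, hb']
      module
    have ec : c - a = (2 : ℝ) • basisVec k := by
      rw [ha, hc]
      module
    have em : m = a + ((m j + 1) / 2) • (b - a) + ((m k + 1) / 2) • (c - a) := by
      rw [eb, ec, ha, h.ext_iff]
      simp [c1, c2, c3, c4, c5, c6, hi]
    rw [em] at hgm
    obtain ⟨⟨n, hn⟩, n', hn'⟩ := hΛ.exists_half_int two_pos (k := 0) (Or.inl rfl)
      (mem _ _ p2 p2) (mem _ _ p1 p2) (mem _ _ p2 p1)
      (by rw [eb, h.inner_eq]; norm_num [c3, c4]) (by rw [ec, h.inner_eq]; norm_num [c5, c6])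
      (by rw [eb, ec, h.inner_eq]; simp [c3, c4, c5, c6]) hgm
    -- Half-integral tile coordinates in `[0, 1]` mean that `m j` and `m k` lie in `{-1, 0, 1}`: the
    -- point is the face centre, an edge midpoint or a corner.
    have cases : ∀ l, (∃ n : ℤ, 2 * ((m l + 1) / 2) = n) → m l = 0 ∨ (m l = 1 ∨ m l = -1) := by
      rintro l ⟨n, hn⟩
      have := abs_le.1 (hb l)
      have n0 : 0 ≤ n := by
        have : (0 : ℝ) ≤ n := by linarith
        exact_mod_cast this
      have n2 : n ≤ 2 := by
        have : (n : ℝ) ≤ 2 := by linarith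
        exact_mod_cast this
      interval_cases n
      · right; right; push_cast at hn; linarith
      · left; push_cast at hn; linarith
      · right; left; push_cast at hn; linarith
    rcases cases j ⟨n, hn⟩ with hj | hj <;> rcases cases k ⟨n', hn'⟩ with hk | hk
    · exact exists_halfTurn_cube_center h hs hi hj hk
    · exact exists_halfTurn_cube_edge h.swap_right hs hk hi rfl hj
    · exact exists_halfTurn_cube_edge h hs hj hi rfl hk
    · exact absurd (h.forall_iff.2 ⟨hi.symm ▸ hs, hj, hk⟩) hmV

/-! ### The tetrahedron, the octahedron and the icosahedron -/

theorem E3.ext_iff {x y : E3} : x = y ↔ x 0 = y 0 ∧ x 1 = y 1 ∧ x 2 = y 2 :=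
  IsAxes.ext_iff ⟨by decide, by decide, by decide⟩

/-- Two free signs parametrize the vertices, the third coordinate being their product; this makes
the verification a finite case check. -/
theorem mem_tetrahedron {x : E3} :
    x ∈ ({!₂[1, 1, 1], !₂[1, -1, -1], !₂[-1, 1, -1], !₂[-1, -1, 1]} : Set E3) ↔
      (x 0 = 1 ∨ x 0 = -1) ∧ (x 1 = 1 ∨ x 1 = -1) ∧ x 2 = x 0 * x 1 := by
  simp only [mem_insert_iff, mem_singleton_iff, E3.ext_iff]
  constructor
  · rintro (⟨h0, h1, h2⟩ | ⟨h0, h1, h2⟩ | ⟨h0, h1, h2⟩ | ⟨h0, h1, h2⟩) <;> simp_all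
  · rintro ⟨h0 | h0, h1 | h1, h2⟩ <;> simp [h0, h1, h2]

/-- The tetrahedron has no central symmetry, so the conditions are checked over all choices of
signs. Any two distinct vertices have inner product `-1`. -/
theorem isDeltahedral_tetrahedron :
    IsDeltahedral {!₂[1, 1, 1], !₂[1, -1, -1], !₂[-1, 1, -1], !₂[-1, -1, 1]} 3 (-1) (2 * √2) where
  finite := toFinite _
  pos := by positivity
  sq_eq := by
    rw [mul_pow, Real.sq_sqrt zero_le_two]
    norm_num
  add_pos := by norm_num
  inner_self v hv := by
    obtain ⟨h0, h1, h2⟩ := mem_tetrahedron.1 hv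
    rw [E3.inner_eq, h2]
    rcases h0 with h0 | h0 <;> rcases h1 with h1 | h1 <;> rw [h0, h1] <;> norm_num
  inner_le v hv w hw hne := by
    obtain ⟨v0, v1, v2⟩ := mem_tetrahedron.1 hv
    obtain ⟨w0, w1, w2⟩ := mem_tetrahedron.1 hw
    rw [Ne, E3.ext_iff, v2, w2] at hne
    rw [E3.inner_eq, v2, w2]
    rcases v0 with v0 | v0 <;> rcases v1 with v1 | v1 <;> rcases w0 with w0 | w0 <;>
      rcases w1 with w1 | w1 <;> (revert hne; norm_num [v0, v1, w0, w1])
  reflection_mem a ha b hb hab v hv := by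
    obtain ⟨a0, a1, a2⟩ := mem_tetrahedron.1 ha
    obtain ⟨b0, b1, b2⟩ := mem_tetrahedron.1 hb
    obtain ⟨v0, v1, v2⟩ := mem_tetrahedron.1 hv
    rw [mem_tetrahedron]
    simp only [reflection_line_apply, E3.inner_eq, PiLp.add_apply, a2, b2, v2] at hab ⊢
    rcases a0 with a0 | a0 <;> rcases a1 with a1 | a1 <;> rcases b0 with b0 | b0 <;>
      rcases b1 with b1 | b1 <;> (revert hab; norm_num [a0, a1, b0, b1]) <;>
      rcases v0 with v0 | v0 <;> rcases v1 with v1 | v1 <;> norm_num [v0, v1]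
  ne_smul a ha b hb hab v hv k hk := by
    obtain ⟨a0, a1, a2⟩ := mem_tetrahedron.1 ha
    obtain ⟨b0, b1, b2⟩ := mem_tetrahedron.1 hb
    obtain ⟨v0, v1, v2⟩ := mem_tetrahedron.1 hv
    rw [E3.ext_iff] at hk
    simp only [PiLp.add_apply, PiLp.smul_apply, smul_eq_mul, a2, b2, v2, E3.inner_eq] at hab hk
    rcases v0 with v0 | v0 <;> rcases v1 with v1 | v1 <;> rw [v0, v1] at hk <;>
    rcases a0 with a0 | a0 <;> rcases a1 with a1 | a1 <;> rcases b0 with b0 | b0 <;>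
      rcases b1 with b1 | b1 <;> (revert hab hk; norm_num [a0, a1, b0, b1])

/-- A criterion for sets which are symmetric around the origin. -/
theorem IsDeltahedral.of_neg_mem {V : Set E3} {r κ ℓ : ℝ} (finite : V.Finite) (pos : 0 < ℓ)
    (sq_eq : ℓ ^ 2 = 2 * (r - κ)) (nonneg : 0 ≤ κ) (inner_self : ∀ v ∈ V, inner ℝ v v = r)
    (neg_mem : ∀ v ∈ V, -v ∈ V) (inner_eq : ∀ v ∈ V, ∀ w ∈ V,
      v = w ∨ v = -w ∨ inner ℝ v w = κ ∨ inner ℝ v w = -κ)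
    (turn : ∀ a ∈ V, ∀ b ∈ V, ∀ c ∈ V, inner ℝ a b = κ → inner ℝ a c = κ → inner ℝ b c = κ →
      (2 * κ / (r + κ)) • (a + b) - c ∈ V) : IsDeltahedral V r κ ℓ := by
  have hlt : κ < r := by nlinarith
  have add_pos : 0 < r + κ := by linarith
  have inner_le : ∀ v ∈ V, ∀ w ∈ V, v ≠ w → inner ℝ v w ≤ κ := by
    intro v hv w hw hne
    rcases inner_eq v hv w hw with e | e | e | e
    · exact absurd e hne
    · rw [e, inner_neg_left, inner_self w hw]
      linarith
    · exact e.le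
    · linarith
  have not_smul : ∀ a ∈ V, ∀ b ∈ V, inner ℝ a b = κ → ∀ v ∈ V, ∀ k : ℝ, 0 ≤ k →
      v ≠ k • (a + b) := by
    intro a ha b hb hab v hv k hk0 hk
    have e1 : inner ℝ v a = k * (r + κ) := by
      rw [hk, inner_smul_left, inner_add_left, inner_self a ha, real_inner_comm, hab]
      simp
    have e1' : inner ℝ v b = k * (r + κ) := by
      rw [hk, inner_smul_left, inner_add_left, inner_self b hb, hab, add_comm]
      simp
    have e2 : inner ℝ v v = 2 * k ^ 2 * (r + κ) := by
      conv_lhs => rw [hk, inner_smul_right, ← hk, inner_add_right, e1, e1']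
      ring
    rw [inner_self v hv] at e2
    -- A vertex on the axis satisfies `r = 2 k² (r + κ)`. Together with `k (r + κ) = ± κ` this gives
    -- `(r - κ) (r + 2 κ) = 0`, impossible for `0 ≤ κ < r`.
    have hsq : (k * (r + κ)) ^ 2 = κ ^ 2 → False := by
      intro e3
      have e4 : (r - κ) * (r + 2 * κ) = 0 := by linear_combination (r + κ) * e2 + 2 * e3
      have := mul_pos (_root_.sub_pos.2 hlt) (show 0 < r + 2 * κ by linarith)
      linarith
    rcases inner_eq v hv a ha with e | e | e | e
    · rw [e, hab, ← e1, e, inner_self a ha] at e1'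
      linarith
    · rw [e, inner_neg_left, inner_self a ha] at e1
      have := mul_nonneg hk0 add_pos.le
      linarith
    · exact hsq (by rw [← e1, e])
    · exact hsq (by rw [← e1, e, neg_sq])
  refine ⟨finite, pos, sq_eq, add_pos, inner_self, inner_le, ?_, ?_⟩
  · intro a ha b hb hab v hv
    rw [reflection_add_apply (inner_self a ha) (inner_self b hb) hab add_pos]
    have h0 : r + κ ≠ 0 := add_pos.ne'
    have hba : inner ℝ b a = κ := by rw [real_inner_comm, hab]
    rcases inner_eq a ha v hv with rfl | e1 | e1
    · rw [inner_self a ha, hba, div_self h0, one_smul, add_sub_cancel_left]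
      exact hb
    · obtain rfl : v = -a := by rw [e1, neg_neg]
      rw [inner_neg_right, inner_neg_right, inner_self a ha, hba, ← neg_add, neg_div, div_self h0]
      convert neg_mem b hb using 1
      module
    rcases inner_eq b hb v hv with rfl | e2 | e2
    · rw [inner_self b hb, hab, add_comm κ, div_self h0, one_smul, add_sub_cancel_right]
      exact ha
    · obtain rfl : v = -b := by rw [e2, neg_neg]
      rw [inner_neg_right, inner_neg_right, inner_self b hb, hab, ← neg_add, add_comm κ, neg_div,
        div_self h0]
      convert neg_mem a ha using 1
      module
    -- Now `v` is none of `± a`, `± b`. Opposite inner products with `a` and `b` put `v` orthogonal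
    -- to the axis, so it goes to `-v`; equal ones reduce to `turn`, for `v` or for `-v`.
    rcases e1 with e1 | e1 <;> rcases e2 with e2 | e2 <;> rw [e1, e2]
    · rw [← two_mul]
      exact turn a ha b hb v hv hab e1 e2
    · rw [add_neg_cancel, zero_div, zero_smul, zero_sub]
      exact neg_mem v hv
    · rw [neg_add_cancel, zero_div, zero_smul, zero_sub]
      exact neg_mem v hv
    · convert neg_mem _ (turn a ha b hb (-v) (neg_mem v hv) hab
        (by rw [inner_neg_right, e1, neg_neg]) (by rw [inner_neg_right, e2, neg_neg])) using 1
      rw [← neg_add, ← two_mul, neg_div]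
      module
  · intro a ha b hb hab v hv k hk
    rcases le_total 0 k with h0 | h0
    · exact not_smul a ha b hb hab v hv k h0 hk
    · exact not_smul a ha b hb hab (-v) (neg_mem v hv) (-k) (by linarith) (by rw [hk, neg_smul])


theorem mem_octahedron {x : E3} :
    x ∈ ({!₂[1, 0, 0], !₂[-1, 0, 0], !₂[0, 1, 0], !₂[0, -1, 0], !₂[0, 0, 1], !₂[0, 0, -1]} :
      Set E3) ↔ ∃ i, x = basisVec i ∨ x = -basisVec i := by
  have e : basisVec 0 = !₂[1, 0, 0] ∧ basisVec 1 = !₂[0, 1, 0] ∧ basisVec 2 = !₂[0, 0, 1] := by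
    refine ⟨?_, ?_, ?_⟩ <;> rw [E3.ext_iff] <;> simp [basisVec]
  have e' : -basisVec 0 = !₂[-1, 0, 0] ∧ -basisVec 1 = !₂[0, -1, 0] ∧
      -basisVec 2 = !₂[0, 0, -1] := by
    refine ⟨?_, ?_, ?_⟩ <;> rw [E3.ext_iff] <;> simp [basisVec]
  rw [← e.1, ← e.2.1, ← e.2.2, ← e'.1, ← e'.2.1, ← e'.2.2]
  simp only [mem_insert_iff, mem_singleton_iff, Fin.exists_fin_succ, IsEmpty.exists_iff,
    Fin.succ_zero_eq_one, Fin.succ_one_eq_two, or_false, or_assoc]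

theorem inner_basisVec (i j : Fin 3) :
    inner ℝ (basisVec i) (basisVec j) = if i = j then 1 else 0 := by
  simp [basisVec, EuclideanSpace.inner_single_left]

/-- With `κ = 0`, the third corner of a face is orthogonal to the axis of the opposite edge, and the
half-turn sends it to its antipode. -/
theorem isDeltahedral_octahedron : IsDeltahedral
    {!₂[1, 0, 0], !₂[-1, 0, 0], !₂[0, 1, 0], !₂[0, -1, 0], !₂[0, 0, 1], !₂[0, 0, -1]} 1 0 √2 := by
  have neg : ∀ v ∈ ({!₂[1, 0, 0], !₂[-1, 0, 0], !₂[0, 1, 0], !₂[0, -1, 0], !₂[0, 0, 1],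
      !₂[0, 0, -1]} : Set E3), -v ∈ ({!₂[1, 0, 0], !₂[-1, 0, 0], !₂[0, 1, 0], !₂[0, -1, 0],
      !₂[0, 0, 1], !₂[0, 0, -1]} : Set E3) := by
    intro v hv
    obtain ⟨i, h⟩ := mem_octahedron.1 hv
    refine mem_octahedron.2 ⟨i, ?_⟩
    rcases h with rfl | rfl
    · exact Or.inr rfl
    · exact Or.inl (neg_neg _)
  refine IsDeltahedral.of_neg_mem (toFinite _) (by positivity) ?_ le_rfl ?_ neg ?_ ?_
  · rw [Real.sq_sqrt zero_le_two]
    norm_num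
  · intro v hv
    obtain ⟨i, rfl | rfl⟩ := mem_octahedron.1 hv <;>
      simp only [inner_neg_neg, inner_basisVec, if_true]
  · intro v hv w hw
    obtain ⟨i, hi⟩ := mem_octahedron.1 hv
    obtain ⟨j, hj⟩ := mem_octahedron.1 hw
    by_cases hij : i = j
    · subst hij
      rcases hi with rfl | rfl <;> rcases hj with rfl | rfl <;> simp
    · right; right; left
      rcases hi with rfl | rfl <;> rcases hj with rfl | rfl <;> simp [inner_basisVec, hij]
  · intro a _ b _ c hc _ _ _
    rw [mul_zero, zero_div, zero_smul, zero_sub]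
    exact neg c hc

/-! ### The icosahedron as three golden rectangles -/

/-- The corners of a golden rectangle in the plane of the coordinates `j` and `k`. -/
def IsGolden (i j k : Fin 3) (x : E3) : Prop :=
  ∃ s t : ℝ, (s = 1 ∨ s = -1) ∧ (t = 1 ∨ t = -1) ∧
    x i = 0 ∧ x j = s ∧ x k = t * Real.goldenRatio

/-- The vertices of a regular icosahedron are the corners of three golden rectangles. -/
def IsIcosahedral (i j k : Fin 3) (x : E3) : Prop :=
  IsGolden i j k x ∨ IsGolden j k i x ∨ IsGolden k i j x

theorem IsIcosahedral.rotate {i j k : Fin 3} {x : E3} (h : IsIcosahedral i j k x) :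
    IsIcosahedral j k i x := by
  unfold IsIcosahedral at *
  tauto

theorem IsGolden.neg {i j k : Fin 3} {x : E3} (h : IsGolden i j k x) : IsGolden i j k (-x) := by
  obtain ⟨s, t, hs, ht, h0, h1, h2⟩ := h
  refine ⟨-s, -t, ?_, ?_, by simp [h0], by simp [h1], by simp [h2]⟩
  · rcases hs with rfl | rfl <;> simp
  · rcases ht with rfl | rfl <;> simp

theorem IsIcosahedral.neg {i j k : Fin 3} {x : E3} (h : IsIcosahedral i j k x) :
    IsIcosahedral i j k (-x) :=
  Or.imp IsGolden.neg (Or.imp IsGolden.neg IsGolden.neg) h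

theorem IsAxes.rotate {i j k : Fin 3} (h : IsAxes i j k) : IsAxes j k i :=
  ⟨h.jk, h.ik.symm, h.ij.symm⟩

theorem eq_or_eq_neg_of_sign {s t : ℝ} (hs : s = 1 ∨ s = -1) (ht : t = 1 ∨ t = -1) :
    s = t ∨ s = -t := by
  rcases hs with rfl | rfl <;> rcases ht with rfl | rfl <;> norm_num

/-- The inner product is `s s' + t t' φ²`; with mixed signs it is `± (φ² - 1) = ± φ`. -/
theorem IsGolden.inner_same {i j k : Fin 3} (h : IsAxes i j k) {x y : E3} {s t s' t' : ℝ}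
    (hs : s = 1 ∨ s = -1) (ht : t = 1 ∨ t = -1) (hs' : s' = 1 ∨ s' = -1) (ht' : t' = 1 ∨ t' = -1)
    (hx : x i = 0 ∧ x j = s ∧ x k = t * Real.goldenRatio)
    (hy : y i = 0 ∧ y j = s' ∧ y k = t' * Real.goldenRatio) :
    (s = s' ∧ t = t' ∧ x = y) ∨ (s = -s' ∧ t = -t' ∧ x = -y) ∨
      (s = -s' ∧ t = t' ∧ inner ℝ x y = Real.goldenRatio) ∨
      (s = s' ∧ t = -t' ∧ inner ℝ x y = -Real.goldenRatio) := by
  have hφ := Real.goldenRatio_sq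
  have a := mul_self_of_sign hs'
  have b := mul_self_of_sign ht'
  rw [h.inner_eq, h.ext_iff, h.ext_iff, PiLp.neg_apply, PiLp.neg_apply, PiLp.neg_apply, hx.1,
    hx.2.1, hx.2.2, hy.1, hy.2.1, hy.2.2]
  rcases eq_or_eq_neg_of_sign hs hs' with rfl | rfl <;>
    rcases eq_or_eq_neg_of_sign ht ht' with rfl | rfl
  · exact Or.inl ⟨rfl, rfl, rfl, rfl, rfl⟩
  · refine Or.inr (Or.inr (Or.inr ⟨rfl, rfl, ?_⟩))
    linear_combination a - Real.goldenRatio ^ 2 * b - hφ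
  · refine Or.inr (Or.inr (Or.inl ⟨rfl, rfl, ?_⟩))
    linear_combination -a + Real.goldenRatio ^ 2 * b + hφ
  · exact Or.inr (Or.inl ⟨rfl, rfl, by simp, rfl, by simp⟩)

/-- The supports of the two vectors share a single axis, so the inner product is the one term `t s'
φ`. -/
theorem IsGolden.inner_next {i j k : Fin 3} (h : IsAxes i j k) {x y : E3} {s t s' t' : ℝ}
    (ht : t = 1 ∨ t = -1) (hs' : s' = 1 ∨ s' = -1)
    (hx : x i = 0 ∧ x j = s ∧ x k = t * Real.goldenRatio)
    (hy : y j = 0 ∧ y k = s' ∧ y i = t' * Real.goldenRatio) :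
    (s' = t ∧ inner ℝ x y = Real.goldenRatio) ∨ (s' = -t ∧ inner ℝ x y = -Real.goldenRatio) := by
  have a := mul_self_of_sign ht
  rw [h.inner_eq, hx.1, hx.2.1, hx.2.2, hy.1, hy.2.1, hy.2.2]
  rcases eq_or_eq_neg_of_sign hs' ht with rfl | rfl
  · refine Or.inl ⟨rfl, ?_⟩
    linear_combination Real.goldenRatio * a
  · refine Or.inr ⟨rfl, ?_⟩
    linear_combination -Real.goldenRatio * a

theorem IsIcosahedral.inner_self {i j k : Fin 3} (h : IsAxes i j k) {x : E3}
    (hx : IsIcosahedral i j k x) : inner ℝ x x = 1 + Real.goldenRatio ^ 2 := by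
  have key : ∀ {i j k : Fin 3} (_ : IsAxes i j k) {x : E3}, IsGolden i j k x →
      inner ℝ x x = 1 + Real.goldenRatio ^ 2 := by
    rintro i j k h x ⟨s, t, hs, ht, h0, h1, h2⟩
    rw [h.inner_eq, h0, h1, h2]
    linear_combination mul_self_of_sign hs + Real.goldenRatio ^ 2 * mul_self_of_sign ht
  rcases hx with hx | hx | hx
  exacts [key h hx, key h.rotate hx, key h.rotate.rotate hx]

theorem IsIcosahedral.inner_eq {i j k : Fin 3} (h : IsAxes i j k) {x y : E3}
    (hx : IsIcosahedral i j k x) (hy : IsIcosahedral i j k y) :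
    x = y ∨ x = -y ∨ inner ℝ x y = Real.goldenRatio ∨ inner ℝ x y = -Real.goldenRatio := by
  have key : ∀ {i j k : Fin 3} (_ : IsAxes i j k), IsGolden i j k x → IsIcosahedral i j k y →
      x = y ∨ x = -y ∨ inner ℝ x y = Real.goldenRatio ∨ inner ℝ x y = -Real.goldenRatio := by
    rintro i j k h ⟨s, t, hs, ht, hx⟩
      (⟨s', t', hs', ht', hy⟩ | ⟨s', t', hs', ht', hy⟩ | ⟨s', t', hs', ht', hy⟩)
    · rcases IsGolden.inner_same h hs ht hs' ht' hx hy with e | e | e | e <;>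
        simp only [e, true_or, or_true]
    · rcases IsGolden.inner_next h ht hs' hx hy with e | e <;> simp only [e, true_or, or_true]
    · rw [real_inner_comm]
      rcases IsGolden.inner_next h.rotate.rotate ht' hs hy hx with e | e <;>
        simp only [e, true_or, or_true]
  rcases hx with hx | hx | hx
  exacts [key h hx hy, key h.rotate hx hy.rotate, key h.rotate.rotate hx hy.rotate.rotate]

/-- The half-turn in the midpoint of the edge `a b` takes the third corner `c` of a face to a
vertex. -/
theorem IsIcosahedral.turn {i j k : Fin 3} (h : IsAxes i j k) {a b c : E3}
    (ha : IsIcosahedral i j k a) (hb : IsIcosahedral i j k b) (hc : IsIcosahedral i j k c)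
    (hab : inner ℝ a b = Real.goldenRatio) (hac : inner ℝ a c = Real.goldenRatio)
    (hbc : inner ℝ b c = Real.goldenRatio) :
    IsIcosahedral i j k ((Real.goldenRatio - 1) • (a + b) - c) := by
  have hφ := Real.goldenRatio_sq
  have hpos := Real.goldenRatio_pos
  have same : ∀ {i j k : Fin 3} (_ : IsAxes i j k) {x y : E3} {s t s' t' : ℝ}
      (_ : s = 1 ∨ s = -1) (_ : t = 1 ∨ t = -1) (_ : s' = 1 ∨ s' = -1) (_ : t' = 1 ∨ t' = -1)
      (_ : x i = 0 ∧ x j = s ∧ x k = t * Real.goldenRatio)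
      (_ : y i = 0 ∧ y j = s' ∧ y k = t' * Real.goldenRatio)
      (_ : inner ℝ x y = Real.goldenRatio), s = -s' ∧ t = t' := by
    intro i j k h x y s t s' t' hs ht hs' ht' hx hy e
    rcases IsGolden.inner_same h hs ht hs' ht' hx hy with ⟨-, -, e'⟩ | ⟨-, -, e'⟩ | e' | e'
    · rw [e', IsIcosahedral.inner_self h (Or.inl ⟨s', t', hs', ht', hy⟩)] at e
      linarith
    · rw [e', inner_neg_left, IsIcosahedral.inner_self h (Or.inl ⟨s', t', hs', ht', hy⟩)] at e
      nlinarith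
    · exact ⟨e'.1, e'.2.1⟩
    · linarith [e'.2.2]
  have next : ∀ {i j k : Fin 3} (_ : IsAxes i j k) {x y : E3} {s t s' t' : ℝ}
      (_ : t = 1 ∨ t = -1) (_ : s' = 1 ∨ s' = -1)
      (_ : x i = 0 ∧ x j = s ∧ x k = t * Real.goldenRatio)
      (_ : y j = 0 ∧ y k = s' ∧ y i = t' * Real.goldenRatio)
      (_ : inner ℝ x y = Real.goldenRatio), s' = t := by
    intro i j k h x y s t s' t' ht hs' hx hy e
    rcases IsGolden.inner_next h ht hs' hx hy with e' | e'
    · exact e'.1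
    · linarith [e'.2]
  have contra : ∀ {s : ℝ}, (s = 1 ∨ s = -1) → s = -s → False := by
    intro s hs e
    have := mul_self_of_sign hs
    have : s = 0 := by linarith
    simp [this] at *
  have neg : ∀ {s : ℝ}, (s = 1 ∨ s = -1) → -s = 1 ∨ -s = -1 := by
    rintro s (rfl | rfl) <;> simp
  -- By cyclic symmetry `a` may be taken in the first rectangle. Of the nine placements of `b` and
  -- `c`, adjacency makes four contradictory through signs; in the other five it fixes enough signs
  -- to recognize the image, using `φ² = φ + 1`.
  have key : ∀ {i j k : Fin 3} (_ : IsAxes i j k), IsGolden i j k a → IsIcosahedral i j k b →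
      IsIcosahedral i j k c → IsIcosahedral i j k ((Real.goldenRatio - 1) • (a + b) - c) := by
    rintro i j k h ⟨s, t, hs, ht, ha⟩
      (⟨s', t', hs', ht', hb⟩ | ⟨s', t', hs', ht', hb⟩ | ⟨s', t', hs', ht', hb⟩)
      (⟨u, v, hu, hv, hc⟩ | ⟨u, v, hu, hv, hc⟩ | ⟨u, v, hu, hv, hc⟩)
    · obtain ⟨rfl, rfl⟩ := same h hs ht hs' ht' ha hb hab
      obtain ⟨e, -⟩ := same h hs ht hu hv ha hc hac
      obtain ⟨e', -⟩ := same h hs' ht' hu hv hb hc hbc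
      exact (contra hu (by linarith)).elim
    · obtain ⟨rfl, rfl⟩ := same h hs ht hs' ht' ha hb hab
      obtain rfl := next h ht hu ha hc hac
      refine Or.inr (Or.inl ⟨u, -v, hu, neg hv, ?_, ?_, ?_⟩)
      all_goals
        simp only [PiLp.sub_apply, PiLp.smul_apply, PiLp.add_apply, smul_eq_mul, ha, hb, hc]
      · ring
      · linear_combination 2 * u * hφ
      · ring
    · obtain ⟨rfl, rfl⟩ := same h hs ht hs' ht' ha hb hab
      have e := next h.rotate.rotate hv hs hc ha (by rw [real_inner_comm, hac])
      have e' := next h.rotate.rotate hv hs' hc hb (by rw [real_inner_comm, hbc])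
      exact (contra hs' (by linarith)).elim
    · obtain rfl := next h ht hs' ha hb hab
      obtain ⟨rfl, rfl⟩ := same h hs ht hu hv ha hc hac
      refine Or.inr (Or.inr ⟨t', -u, ht', neg hu, ?_, ?_, ?_⟩)
      all_goals
        simp only [PiLp.sub_apply, PiLp.smul_apply, PiLp.add_apply, smul_eq_mul, ha, hb, hc]
      · linear_combination s' * hφ
      · linear_combination t' * hφ
      · ring
    · obtain rfl := next h ht hs' ha hb hab
      obtain rfl := next h ht hu ha hc hac
      obtain ⟨e, -⟩ := same h.rotate hs' ht' hu hv hb hc hbc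
      exact (contra hu e).elim
    · obtain rfl := next h ht hs' ha hb hab
      obtain rfl := next h.rotate.rotate hv hs hc ha (by rw [real_inner_comm, hac])
      obtain rfl := next h.rotate ht' hu hb hc hbc
      refine Or.inl ⟨-s, s', neg hs, hs', ?_, ?_, ?_⟩
      all_goals
        simp only [PiLp.sub_apply, PiLp.smul_apply, PiLp.add_apply, smul_eq_mul, ha, hb, hc]
      · linear_combination u * hφ
      · ring
      · linear_combination s' * hφ
    · obtain rfl := next h.rotate.rotate ht' hs hb ha (by rw [real_inner_comm, hab])
      obtain ⟨e, -⟩ := same h hs ht hu hv ha hc hac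
      have e' := next h.rotate.rotate ht' hu hb hc hbc
      exact (contra hs (by linarith)).elim
    · obtain rfl := next h.rotate.rotate ht' hs hb ha (by rw [real_inner_comm, hab])
      obtain rfl := next h ht hu ha hc hac
      obtain rfl := next h.rotate hv hs' hc hb (by rw [real_inner_comm, hbc])
      refine Or.inr (Or.inr ⟨-s', s, neg hs', hs, ?_, ?_, ?_⟩)
      all_goals
        simp only [PiLp.sub_apply, PiLp.smul_apply, PiLp.add_apply, smul_eq_mul, ha, hb, hc]
      · linear_combination u * hφ
      · ring
      · linear_combination s * hφ
    · obtain rfl := next h.rotate.rotate ht' hs hb ha (by rw [real_inner_comm, hab])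
      obtain rfl := next h.rotate.rotate hv hs hc ha (by rw [real_inner_comm, hac])
      obtain ⟨rfl, -⟩ := same h.rotate.rotate hs' ht' hu hv hb hc hbc
      refine Or.inr (Or.inl ⟨t, -u, ht, neg hu, ?_, ?_, ?_⟩)
      all_goals
        simp only [PiLp.sub_apply, PiLp.smul_apply, PiLp.add_apply, smul_eq_mul, ha, hb, hc]
      · linear_combination s * hφ
      · linear_combination t * hφ
      · ring
  rcases ha with ha | ha | ha
  · exact key h ha hb hc
  · exact (key h.rotate ha hb.rotate hc.rotate).rotate.rotate
  · exact (key h.rotate.rotate ha hb.rotate.rotate hc.rotate.rotate).rotate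

/-- The vertex set of the icosahedron. -/
def icosahedronVertices : Set E3 :=
  {x | ∃ s t : ℝ, (s = 1 ∨ s = -1) ∧ (t = Real.goldenRatio ∨ t = -Real.goldenRatio) ∧
    (x = !₂[0, s, t] ∨ x = !₂[s, t, 0] ∨ x = !₂[t, 0, s])}

theorem mem_icosahedronVertices {x : E3} : x ∈ icosahedronVertices ↔ IsIcosahedral 0 1 2 x := by
  constructor
  · rintro ⟨s, t, hs, ht, h⟩
    obtain ⟨t, ht', rfl⟩ : ∃ t', (t' = 1 ∨ t' = -1) ∧ t = t' * Real.goldenRatio := by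
      rcases ht with rfl | rfl
      · exact ⟨1, Or.inl rfl, (one_mul _).symm⟩
      · exact ⟨-1, Or.inr rfl, (neg_one_mul _).symm⟩
    rcases h with rfl | rfl | rfl
    · exact Or.inl ⟨s, t, hs, ht', by simp, by simp, by simp⟩
    · exact Or.inr (Or.inr ⟨s, t, hs, ht', by simp, by simp, by simp⟩)
    · exact Or.inr (Or.inl ⟨s, t, hs, ht', by simp, by simp, by simp⟩)
  · have sign : ∀ t : ℝ, t = 1 ∨ t = -1 →
        t * Real.goldenRatio = Real.goldenRatio ∨ t * Real.goldenRatio = -Real.goldenRatio := by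
      rintro t (rfl | rfl) <;> simp
    rintro (⟨s, t, hs, ht, h0, h1, h2⟩ | ⟨s, t, hs, ht, h0, h1, h2⟩ | ⟨s, t, hs, ht, h0, h1, h2⟩)
    · exact ⟨s, _, hs, sign t ht, Or.inl (by rw [E3.ext_iff]; simp [h0, h1, h2])⟩
    · exact ⟨s, _, hs, sign t ht, Or.inr (Or.inr (by rw [E3.ext_iff]; simp [h0, h1, h2]))⟩
    · exact ⟨s, _, hs, sign t ht, Or.inr (Or.inl (by rw [E3.ext_iff]; simp [h0, h1, h2]))⟩

theorem icosahedronVertices_finite : icosahedronVertices.Finite := by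
  refine ((toFinite ({0, 1, -1, Real.goldenRatio, -Real.goldenRatio} : Set ℝ)).prod
    ((toFinite ({0, 1, -1, Real.goldenRatio, -Real.goldenRatio} : Set ℝ)).prod
    (toFinite ({0, 1, -1, Real.goldenRatio, -Real.goldenRatio} : Set ℝ)))).image
    (fun t : ℝ × ℝ × ℝ => (!₂[t.1, t.2.1, t.2.2] : E3)) |>.subset ?_
  rintro x ⟨s, t, hs, ht, h⟩
  have hs' : s ∈ ({0, 1, -1, Real.goldenRatio, -Real.goldenRatio} : Set ℝ) := by
    rcases hs with rfl | rfl <;> simp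
  have ht' : t ∈ ({0, 1, -1, Real.goldenRatio, -Real.goldenRatio} : Set ℝ) := by
    rcases ht with rfl | rfl <;> simp
  have h0 : (0 : ℝ) ∈ ({0, 1, -1, Real.goldenRatio, -Real.goldenRatio} : Set ℝ) := by simp
  rcases h with rfl | rfl | rfl
  · exact ⟨(0, s, t), ⟨h0, hs', ht'⟩, rfl⟩
  · exact ⟨(s, t, 0), ⟨hs', ht', h0⟩, rfl⟩
  · exact ⟨(t, 0, s), ⟨ht', h0, hs'⟩, rfl⟩

theorem isDeltahedral_icosahedron :
    IsDeltahedral icosahedronVertices (1 + Real.goldenRatio ^ 2) Real.goldenRatio 2 := by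
  have h : IsAxes 0 1 2 := ⟨by decide, by decide, by decide⟩
  have hφ := Real.goldenRatio_sq
  have hpos := Real.goldenRatio_pos
  refine IsDeltahedral.of_neg_mem icosahedronVertices_finite two_pos ?_ hpos.le ?_ ?_ ?_ ?_
  · linear_combination -2 * hφ
  · exact fun v hv => IsIcosahedral.inner_self h (mem_icosahedronVertices.1 hv)
  · exact fun v hv => mem_icosahedronVertices.2 (mem_icosahedronVertices.1 hv).neg
  · exact fun v hv w hw => IsIcosahedral.inner_eq h (mem_icosahedronVertices.1 hv)
      (mem_icosahedronVertices.1 hw)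
  · intro a ha b hb c hc hab hac hbc
    -- Since `1 + φ + φ² = 2 φ²`, the factor in the half-turn is `1 / φ = φ - 1`.
    have e : 2 * Real.goldenRatio / (1 + Real.goldenRatio ^ 2 + Real.goldenRatio) =
        Real.goldenRatio - 1 := by
      rw [div_eq_iff (by positivity)]
      linear_combination -(Real.goldenRatio + 1) * hφ
    rw [e]
    exact mem_icosahedronVertices.2 (IsIcosahedral.turn h (mem_icosahedronVertices.1 ha)
      (mem_icosahedronVertices.1 hb) (mem_icosahedronVertices.1 hc) hab hac hbc)

end Platonic

theorem theorem1p3 :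
    ¬ Platonic.tetrahedron.HasClosedSaddleConnection ∧
    ¬ Platonic.octahedron.HasClosedSaddleConnection ∧
    ¬ Platonic.cube.HasClosedSaddleConnection ∧
    ¬ Platonic.icosahedron.HasClosedSaddleConnection :=
  ⟨Platonic.isDeltahedral_tetrahedron.isRollable.not_hasClosedSaddleConnection,
    Platonic.isDeltahedral_octahedron.isRollable.not_hasClosedSaddleConnection,
    Platonic.cube_isRollable.not_hasClosedSaddleConnection,
    Platonic.isDeltahedral_icosahedron.isRollable.not_hasClosedSaddleConnection⟩
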